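/- Conventions. Put $\epsilon_1=1$, $\epsilon_2=\epsilon_3=-1$, indices modulo $3$. An almost paraquaternionic structure on a smooth manifold $M$ is a rank-3 subbundle $\sigma\subset \mathrm{End}(TM)$ having near each point a smooth local basis $\{J_1,J_2,J_3\}$ (a canonical local basis) with $J_\alpha^2=-\epsilon_\alpha \mathrm{Id}$ and $J_\alpha J_{\alpha+1}=-J_{\alpha+1}J_\alpha=\epsilon_{\alpha+2}J_{\alpha+2}$. If $g$ is a semi-Riemannian metric on $M$ with $g(J_\alpha X,J_\alpha Y)=\epsilon_\alpha g(X,Y)$ for every canonical local basis, then $(M,\sigma,g)$ is almost paraquaternionic hermitian; it is paraquaternionic Kähler if, moreover, $\sigma$ is parallel with respect to the Levi-Civita connection of $g$, i.e. $\nabla_X A$ is a section of $\sigma$ for every local section $A$ of $\sigma$ and every vector field $X$. Let $N$ be a manifold immersed in $M$ by $\iota:N\to M$ such that the induced metric $\iota^*g$ is nondegenerate. $N$ is a paraquaternionic CR-submanifold if there is a smooth distribution $\mathcal D\subset TN$ on which the induced metric is nondegenerate, such that, for every canonical local basis, $J_\alpha\mathcal D_p=\mathcal D_p$ and $J_\alpha\mathcal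 D^\perp_p\subset T_pN^\perp$, where $\mathcal D^\perp$ is the orthogonal complement of $\mathcal D$ in $TN$ (and $T_pN$ is identified with $\iota_*T_pN$). Let $(M',\sigma',g')$ be almost paraquaternionic hermitian. A semi-Riemannian submersion $\pi:N\to M'$ (a smooth surjective submersion with nondegenerate fibres whose differential preserves the scalar products of vectors orthogonal to the fibres) is a paraquaternionic CR-submersion if $\ker\pi_*=\mathcal D^\perp$ and, for each $p\in N$, $\pi_*:\mathcal D_p\to T_{\pi(p)}M'$ is an isometry compatible with the structures: for every canonical local basis $\{J'_\alpha\}$ of $\sigma'$ near $\pi(p)$ there is a canonical local basis $\{J_\alpha\}$ of $\sigma$ near $\iota(p)$ with $\pi_*\circ J_\alpha=J'_\alpha\circ\pi_*$ on $\mathcal D_p$ for $\alpha=1,2,3$. Theorem. Let $N$ be a paraquaternionic CR-submanifold of a paraquaternionic Kähler manifold $(M,\sigma,g)$ and let $(M',\sigma',g')$ be an almost paraquaternionic hermitian manifold. If $\pi:N\to M'$ is a paraquaternionic CR-submersion, then $(M',\sigma',g')$ is a paraquaternionic Kähler manifold. -/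

import Mathlib

open scoped Manifold ContDiff Bundle

noncomputable section

namespace ParaquaternionicCR

section Manifold

variable {E : Type*} [NormedAddCommGroup E] [NormedSpace ℝ E]
  {M : Type*} [TopologicalSpace M] [ChartedSpace E M]

/-- The field `x ↦ J x` of endomorphisms of the tangent spaces is smooth on `U`, as a section of
the bundle `End(TM)`. -/
def SmoothEndOn [IsManifold 𝓘(ℝ, E) ∞ M]
    (J : ∀ x : M, TangentSpace 𝓘(ℝ, E) x →L[ℝ] TangentSpace 𝓘(ℝ, E) x) (U : Set M) : Prop :=
  ContMDiffOn 𝓘(ℝ, E) (𝓘(ℝ, E).prod 𝓘(ℝ, E →L[ℝ] E)) ∞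
    (fun x ↦ Bundle.TotalSpace.mk' (E →L[ℝ] E)
      (E := fun x : M ↦ TangentSpace 𝓘(ℝ, E) x →L[ℝ] TangentSpace 𝓘(ℝ, E) x) x (J x)) U

/-- The vector field `x ↦ X x` is smooth on `U`. -/
def SmoothFieldOn (X : ∀ x : M, TangentSpace 𝓘(ℝ, E) x) (U : Set M)
    [IsManifold 𝓘(ℝ, E) ∞ M] : Prop :=
  ContMDiffOn 𝓘(ℝ, E) (𝓘(ℝ, E).prod 𝓘(ℝ, E)) ∞
    (fun x ↦ Bundle.TotalSpace.mk' E (E := fun x : M ↦ TangentSpace 𝓘(ℝ, E) x) x (X x)) U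

variable (E M) in
/-- A semi-Riemannian metric: a smooth field of nondegenerate symmetric bilinear forms on the
tangent spaces. (For the metrics adapted to an almost paraquaternionic structure the index is
automatically half the dimension, so no constancy of the index has to be required.) -/
structure SemiRiemannianMetric [IsManifold 𝓘(ℝ, E) ∞ M] where
  inner (x : M) : TangentSpace 𝓘(ℝ, E) x →L[ℝ] TangentSpace 𝓘(ℝ, E) x →L[ℝ] ℝ
  symm (x : M) (v w : TangentSpace 𝓘(ℝ, E) x) : inner x v w = inner x w v
  nondegenerate (x : M) (v : TangentSpace 𝓘(ℝ, E) x) (hv : ∀ w, inner x v w = 0) : v = 0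
  contMDiff : ContMDiff 𝓘(ℝ, E) (𝓘(ℝ, E).prod 𝓘(ℝ, E →L[ℝ] E →L[ℝ] ℝ)) ∞
    (fun x ↦ Bundle.TotalSpace.mk' (E →L[ℝ] E →L[ℝ] ℝ)
      (E := fun x : M ↦ TangentSpace 𝓘(ℝ, E) x →L[ℝ] TangentSpace 𝓘(ℝ, E) x →L[ℝ] ℝ)
      x (inner x))

/-- `∇` is the Levi-Civita connection of `g`: it is torsion-free and compatible with `g`. -/
structure IsLeviCivita [IsManifold 𝓘(ℝ, E) ∞ M] [FiniteDimensional ℝ E]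
    (g : SemiRiemannianMetric E M)
    (cov : CovariantDerivative 𝓘(ℝ, E) E (TangentSpace 𝓘(ℝ, E) : M → Type _)) : Prop where
  torsion_eq_zero : haveI := FiniteDimensional.complete ℝ E; cov.torsion = 0
  compatible (x : M) (v : TangentSpace 𝓘(ℝ, E) x) (Y Z : ∀ y : M, TangentSpace 𝓘(ℝ, E) y)
    (hY : MDiffAt (T% Y) x) (hZ : MDiffAt (T% Z) x) :
    (d% (fun y ↦ g.inner y (Y y) (Z y)) x) v
      = g.inner x (cov Y x v) (Z x) + g.inner x (Y x) (cov Z x v)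

/-- The signs `ε₁ = 1`, `ε₂ = ε₃ = -1`; the indices `1, 2, 3` modulo 3 are the elements `0, 1, 2`
of `Fin 3` (with its cyclic addition). -/
def eps : Fin 3 → ℝ := ![1, -1, -1]

/-- `J₁, J₂, J₃` are, over the open set `U`, smooth sections of the family `σ` of subspaces of
`End(T_x M)`, form a basis of `σ x` at each point `x` of `U`, and satisfy
`J_α² = -ε_α Id` and `J_α J_{α+1} = -J_{α+1} J_α = ε_{α+2} J_{α+2}`. -/
structure IsCanonicalLocalBasis [IsManifold 𝓘(ℝ, E) ∞ M]
    (σ : ∀ x : M, Submodule ℝ (TangentSpace 𝓘(ℝ, E) x →L[ℝ] TangentSpace 𝓘(ℝ, E) x))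
    (U : Set M)
    (J : Fin 3 → ∀ x : M, TangentSpace 𝓘(ℝ, E) x →L[ℝ] TangentSpace 𝓘(ℝ, E) x) : Prop where
  isOpen : IsOpen U
  smooth (α : Fin 3) : SmoothEndOn (J α) U
  linearIndependent (x : M) (hx : x ∈ U) : LinearIndependent ℝ (fun α ↦ J α x)
  span_eq (x : M) (hx : x ∈ U) : Submodule.span ℝ (Set.range fun α ↦ J α x) = σ x
  sq (x : M) (hx : x ∈ U) (α : Fin 3) :
    J α x ∘L J α x = (-eps α) • ContinuousLinearMap.id ℝ (TangentSpace 𝓘(ℝ, E) x)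
  mul_next (x : M) (hx : x ∈ U) (α : Fin 3) :
    J α x ∘L J (α + 1) x = eps (α + 2) • J (α + 2) x
  next_mul (x : M) (hx : x ∈ U) (α : Fin 3) :
    J (α + 1) x ∘L J α x = -(eps (α + 2) • J (α + 2) x)

variable (E M) in
/-- An almost paraquaternionic structure: a rank-3 subbundle `σ` of `End(TM)` that admits a
canonical local basis near every point. -/
structure AlmostParaquaternionicStructure [IsManifold 𝓘(ℝ, E) ∞ M] where
  fiber (x : M) : Submodule ℝ (TangentSpace 𝓘(ℝ, E) x →L[ℝ] TangentSpace 𝓘(ℝ, E) x)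
  exists_basis (x : M) : ∃ (U : Set M)
    (J : Fin 3 → ∀ y : M, TangentSpace 𝓘(ℝ, E) y →L[ℝ] TangentSpace 𝓘(ℝ, E) y),
    x ∈ U ∧ IsCanonicalLocalBasis fiber U J

/-- `(M, σ, g)` is an almost paraquaternionic hermitian manifold: `g` is adapted to `σ`, that is,
`g(J_α X, J_α Y) = ε_α g(X, Y)` for every canonical local basis. -/
def IsAlmostParaquaternionicHermitian [IsManifold 𝓘(ℝ, E) ∞ M]
    (σ : AlmostParaquaternionicStructure E M) (g : SemiRiemannianMetric E M) : Prop :=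
  ∀ (U : Set M) (J : Fin 3 → ∀ x : M, TangentSpace 𝓘(ℝ, E) x →L[ℝ] TangentSpace 𝓘(ℝ, E) x),
    IsCanonicalLocalBasis σ.fiber U J → ∀ x ∈ U, ∀ (α : Fin 3) (v w : TangentSpace 𝓘(ℝ, E) x),
      g.inner x (J α x v) (J α x w) = eps α * g.inner x v w

/-- The subbundle `σ` of `End(TM)` is parallel with respect to `∇`: for every local section `A` of
`σ` and every tangent vector `v` at a point `x`, the endomorphism `∇_v A`, which is given by
`(∇_v A) Y = ∇_v (A Y) - A (∇_v Y)`, belongs to `σ_x`. -/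
def IsParallel [IsManifold 𝓘(ℝ, E) ∞ M]
    (cov : CovariantDerivative 𝓘(ℝ, E) E (TangentSpace 𝓘(ℝ, E) : M → Type _))
    (σ : AlmostParaquaternionicStructure E M) : Prop :=
  ∀ (U : Set M) (A : ∀ x : M, TangentSpace 𝓘(ℝ, E) x →L[ℝ] TangentSpace 𝓘(ℝ, E) x),
    IsOpen U → SmoothEndOn A U → (∀ x ∈ U, A x ∈ σ.fiber x) →
    ∀ x ∈ U, ∀ v : TangentSpace 𝓘(ℝ, E) x, ∃ B ∈ σ.fiber x,
      ∀ Y : ∀ y : M, TangentSpace 𝓘(ℝ, E) y, MDiffAt (T% Y) x →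
        cov (fun y ↦ A y (Y y)) x v - A x (cov Y x v) = B (Y x)

/-- `(M, σ, g)` is a paraquaternionic Kähler manifold: it is almost paraquaternionic hermitian, and
`σ` is parallel with respect to the Levi-Civita connection of `g`. -/
structure IsParaquaternionicKahler [IsManifold 𝓘(ℝ, E) ∞ M] [FiniteDimensional ℝ E]
    (σ : AlmostParaquaternionicStructure E M) (g : SemiRiemannianMetric E M) : Prop where
  hermitian : IsAlmostParaquaternionicHermitian σ g
  parallel : ∃ cov : CovariantDerivative 𝓘(ℝ, E) E (TangentSpace 𝓘(ℝ, E) : M → Type _),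
    IsLeviCivita g cov ∧ IsParallel cov σ

/-- `D` is a smooth distribution: for some `r`, the subspaces `D x` are spanned near each point by
`r` smooth, pointwise linearly independent vector fields. -/
def IsSmoothDistribution [IsManifold 𝓘(ℝ, E) ∞ M]
    (D : ∀ x : M, Submodule ℝ (TangentSpace 𝓘(ℝ, E) x)) : Prop :=
  ∃ r : ℕ, ∀ x : M, ∃ (U : Set M) (s : Fin r → ∀ y : M, TangentSpace 𝓘(ℝ, E) y),
    IsOpen U ∧ x ∈ U ∧ (∀ i, SmoothFieldOn (s i) U) ∧
    ∀ y ∈ U, LinearIndependent ℝ (fun i ↦ s i y) ∧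
      Submodule.span ℝ (Set.range fun i ↦ s i y) = D y

end Manifold

section Submanifold

variable {E : Type*} [NormedAddCommGroup E] [NormedSpace ℝ E]
  {M : Type*} [TopologicalSpace M] [ChartedSpace E M] [IsManifold 𝓘(ℝ, E) ∞ M]
  {F : Type*} [NormedAddCommGroup F] [NormedSpace ℝ F]
  {N : Type*} [TopologicalSpace N] [ChartedSpace F N] [IsManifold 𝓘(ℝ, F) ∞ N]

/-- The form induced by `g` on `N` through `ι : N → M`: `(v, w) ↦ g(ι_* v, ι_* w)`. -/
def inducedForm (g : SemiRiemannianMetric E M) (ι : N → M) (p : N) :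
    LinearMap.BilinForm ℝ (TangentSpace 𝓘(ℝ, F) p) :=
  LinearMap.mk₂ ℝ
    (fun v w ↦ g.inner (ι p) (mfderiv 𝓘(ℝ, F) 𝓘(ℝ, E) ι p v) (mfderiv 𝓘(ℝ, F) 𝓘(ℝ, E) ι p w))
    (by intros; simp) (by intros; simp) (by intros; simp) (by intros; simp)

/-- The manifold `N`, immersed in the almost paraquaternionic hermitian manifold `(M, σ, g)` by
`ι`, is a paraquaternionic CR-submanifold with paraquaternionic distribution `D`. -/
structure IsParaquaternionicCRSubmanifold
    (σ : AlmostParaquaternionicStructure E M) (g : SemiRiemannianMetric E M) (ι : N → M)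
    (D : ∀ p : N, Submodule ℝ (TangentSpace 𝓘(ℝ, F) p)) : Prop where
  immersion : Manifold.IsImmersion 𝓘(ℝ, F) 𝓘(ℝ, E) ∞ ι
  nondegenerate (p : N) : (inducedForm (F := F) g ι p).Nondegenerate
  smooth : IsSmoothDistribution D
  nondegenerate_distribution (p : N) : ((inducedForm g ι p).restrict (D p)).Nondegenerate
  /-- `J_α D_p = D_p`. -/
  paraquaternionic (U : Set M)
    (J : Fin 3 → ∀ x : M, TangentSpace 𝓘(ℝ, E) x →L[ℝ] TangentSpace 𝓘(ℝ, E) x)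
    (hJ : IsCanonicalLocalBasis σ.fiber U J) (p : N) (hp : ι p ∈ U) (α : Fin 3) :
    ((D p).map (mfderiv 𝓘(ℝ, F) 𝓘(ℝ, E) ι p).toLinearMap).map (J α (ι p)).toLinearMap
      = (D p).map (mfderiv 𝓘(ℝ, F) 𝓘(ℝ, E) ι p).toLinearMap
  /-- `J_α D_p^⊥` is contained in the normal space of `N` at `p`. -/
  totally_real (U : Set M)
    (J : Fin 3 → ∀ x : M, TangentSpace 𝓘(ℝ, E) x →L[ℝ] TangentSpace 𝓘(ℝ, E) x)
    (hJ : IsCanonicalLocalBasis σ.fiber U J) (p : N) (hp : ι p ∈ U) (α : Fin 3)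
    (v : TangentSpace 𝓘(ℝ, F) p) (hv : v ∈ (inducedForm g ι p).orthogonal (D p))
    (w : TangentSpace 𝓘(ℝ, F) p) :
    g.inner (ι p) (J α (ι p) (mfderiv 𝓘(ℝ, F) 𝓘(ℝ, E) ι p v))
      (mfderiv 𝓘(ℝ, F) 𝓘(ℝ, E) ι p w) = 0

variable {E' : Type*} [NormedAddCommGroup E'] [NormedSpace ℝ E']
  {M' : Type*} [TopologicalSpace M'] [ChartedSpace E' M'] [IsManifold 𝓘(ℝ, E') ∞ M']

/-- `ker f_*`, the vertical subspace of a map `f` at `p`. -/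
def vertical (f : N → M') (p : N) : Submodule ℝ (TangentSpace 𝓘(ℝ, F) p) :=
  (mfderiv 𝓘(ℝ, F) 𝓘(ℝ, E') f p).toLinearMap.ker

/-- `f : (N, h) → (M', g')` is a semi-Riemannian submersion, `h` being a field of bilinear forms on
the tangent spaces of `N` (below: the metric of a nondegenerate submanifold). -/
structure IsSemiRiemannianSubmersion
    (h : ∀ p : N, LinearMap.BilinForm ℝ (TangentSpace 𝓘(ℝ, F) p))
    (g' : SemiRiemannianMetric E' M') (f : N → M') : Prop where
  smooth : ContMDiff 𝓘(ℝ, F) 𝓘(ℝ, E') ∞ f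
  surjective : Function.Surjective f
  surjective_mfderiv (p : N) : Function.Surjective (mfderiv 𝓘(ℝ, F) 𝓘(ℝ, E') f p)
  /-- The fibres are nondegenerate. -/
  nondegenerate_fibers (p : N) :
    ((h p).restrict (vertical (F := F) (E' := E') f p)).Nondegenerate
  /-- `f_*` preserves the scalar products of horizontal vectors. -/
  preserves (p : N) (v w : TangentSpace 𝓘(ℝ, F) p)
    (hv : v ∈ (h p).orthogonal (vertical (F := F) (E' := E') f p))
    (hw : w ∈ (h p).orthogonal (vertical (F := F) (E' := E') f p)) :
    g'.inner (f p) (mfderiv 𝓘(ℝ, F) 𝓘(ℝ, E') f p v) (mfderiv 𝓘(ℝ, F) 𝓘(ℝ, E') f p w) = h p v w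

/-- `f : N → M'` is a paraquaternionic CR-submersion of the CR-submanifold `(N, D)` of `(M, σ, g)`
onto `(M', σ', g')`. The condition `compatible` says that `f_* ∘ J_α = J'_α ∘ f_*` on `D_p`;
`D_p ⊆ T_p N` is regarded there as a subspace of `T_{ι p} M` through `ι_*`. -/
structure IsParaquaternionicCRSubmersion
    (σ : AlmostParaquaternionicStructure E M) (g : SemiRiemannianMetric E M) (ι : N → M)
    (D : ∀ p : N, Submodule ℝ (TangentSpace 𝓘(ℝ, F) p))
    (σ' : AlmostParaquaternionicStructure E' M') (g' : SemiRiemannianMetric E' M')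
    (f : N → M') : Prop where
  submersion : IsSemiRiemannianSubmersion (inducedForm (F := F) g ι) g' f
  vertical_eq (p : N) : vertical (F := F) (E' := E') f p = (inducedForm g ι p).orthogonal (D p)
  isometry (p : N) (v w : TangentSpace 𝓘(ℝ, F) p) (hv : v ∈ D p) (hw : w ∈ D p) :
    g'.inner (f p) (mfderiv 𝓘(ℝ, F) 𝓘(ℝ, E') f p v) (mfderiv 𝓘(ℝ, F) 𝓘(ℝ, E') f p w)
      = inducedForm g ι p v w
  /-- For each `p`, every canonical local basis `J'` of `σ'` near `f p` corresponds at `p` to some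
  canonical local basis `J` of `σ` near `ι p`. -/
  compatible (p : N) (U' : Set M')
    (J' : Fin 3 → ∀ x : M', TangentSpace 𝓘(ℝ, E') x →L[ℝ] TangentSpace 𝓘(ℝ, E') x)
    (hJ' : IsCanonicalLocalBasis σ'.fiber U' J') (hp : f p ∈ U') :
    ∃ (U : Set M) (J : Fin 3 → ∀ x : M, TangentSpace 𝓘(ℝ, E) x →L[ℝ] TangentSpace 𝓘(ℝ, E) x),
      IsCanonicalLocalBasis σ.fiber U J ∧ ι p ∈ U ∧
      ∀ (α : Fin 3), ∀ v ∈ D p, ∃ w ∈ D p,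
        mfderiv 𝓘(ℝ, F) 𝓘(ℝ, E) ι p w = J α (ι p) (mfderiv 𝓘(ℝ, F) 𝓘(ℝ, E) ι p v) ∧
        mfderiv 𝓘(ℝ, F) 𝓘(ℝ, E') f p w = J' α (f p) (mfderiv 𝓘(ℝ, F) 𝓘(ℝ, E') f p v)

end Submanifold

end ParaquaternionicCR

end

/-!
Let `L` be the horizontal lift `T M' → ι_* D` and `R` its adjoint, a left inverse. In coordinates,
`∇'_v Y = R (∇_{l v} (L Y))` defines a connection on `M'`. It is torsion-free because the ambient
connection is torsion-free and `[l u, l v]` is vertical when `[u, v] = 0`, and it is metric because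
`L` is isometric; hence it is the Levi-Civita connection of `g'`. A local section `A` of `σ'`
lifts to a combination of sections of `σ` along `N`, that is `L A = ∑ c_β J_β L`. Since
`∇ J_β` takes values in `σ` and `R` intertwines `J_β` with `J'_β`, differentiating this relation and
applying `R` shows that `∇'_v A` takes values in `σ'`.
-/

noncomputable section

namespace ParaquaternionicCR

open Filter Topology

set_option maxSynthPendingDepth 3

section Calculus

variable {𝕜 X V W : Type*} [NontriviallyNormedField 𝕜]
  [NormedAddCommGroup X] [NormedSpace 𝕜 X] [NormedAddCommGroup V] [NormedSpace 𝕜 V]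
  [NormedAddCommGroup W] [NormedSpace 𝕜 W]

lemma differentiableAt_of_clm_apply [CompleteSpace W] {B : X → W →L[𝕜] V} {c : X → W} {p : X}
    (hB : DifferentiableAt 𝕜 B p) (hinv : (B p).HasLeftInverse)
    (hBc : DifferentiableAt 𝕜 (fun q ↦ B q (c q)) p) : DifferentiableAt 𝕜 c p := by
  obtain ⟨P, hP⟩ := hinv
  have hT : DifferentiableAt 𝕜 (fun q ↦ P ∘L B q) p := (differentiableAt_const P).clm_comp hB
  have hTp : P ∘L B p = ContinuousLinearEquiv.refl 𝕜 W := ContinuousLinearMap.ext hP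
  have hinverse : DifferentiableAt 𝕜 (fun q ↦ (P ∘L B q).inverse) p := by
    refine DifferentiableAt.comp (g := ContinuousLinearMap.inverse) p ?_ hT
    rw [hTp]
    exact (contDiffAt_map_inverse (n := 1) (ContinuousLinearEquiv.refl 𝕜 W)).differentiableAt
      one_ne_zero
  have hinvertible : ∀ᶠ q in 𝓝 p, (P ∘L B q).IsInvertible :=
    hT.continuousAt (by rw [hTp]; exact ContinuousLinearEquiv.nhds _)
  refine (hinverse.clm_apply ((differentiableAt_const P).clm_apply hBc)).congr_of_eventuallyEq ?_
  filter_upwards [hinvertible] with q hq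
  exact (hq.inverse_apply_eq.2 rfl).symm

lemma exists_differentiableAt_coeff [CompleteSpace 𝕜] [FiniteDimensional 𝕜 V]
    {n : Type*} [Fintype n] {K : n → X → V} {a : X → V} {p : X}
    (hK : ∀ β, DifferentiableAt 𝕜 (K β) p) (hli : LinearIndependent 𝕜 fun β ↦ K β p)
    (ha : DifferentiableAt 𝕜 a p)
    (hspan : ∀ᶠ q in 𝓝 p, a q ∈ Submodule.span 𝕜 (Set.range fun β ↦ K β q)) :
    ∃ c : X → n → 𝕜, DifferentiableAt 𝕜 c p ∧ ∀ᶠ q in 𝓝 p, a q = ∑ β, c q β • K β q := by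
  let B (q : X) : (n → 𝕜) →L[𝕜] V := ∑ β, (ContinuousLinearMap.proj β).smulRight (K β q)
  have hB_apply (q : X) (c : n → 𝕜) : B q c = ∑ β, c β • K β q := by simp [B]
  have hB : DifferentiableAt 𝕜 B p := DifferentiableAt.fun_sum fun β _ ↦
    (ContinuousLinearMap.smulRightL 𝕜 (n → 𝕜) V (ContinuousLinearMap.proj β)).differentiableAt.comp
      p (hK β)
  have hinj : Function.Injective (B p) := (injective_iff_map_eq_zero _).2 fun c hc ↦
    funext (Fintype.linearIndependent_iff.1 hli c ((hB_apply p c).symm.trans hc))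
  obtain ⟨c, hc⟩ := (hspan.mono fun q hq ↦ (Submodule.mem_span_range_iff_exists_fun 𝕜).1 hq).choice
  have hBc : (fun q ↦ B q (c q)) =ᶠ[𝓝 p] a := hc.mono fun q hq ↦ (hB_apply q _).trans hq
  have := FiniteDimensional.complete 𝕜 (n → 𝕜)
  exact ⟨c, differentiableAt_of_clm_apply hB
    (ContinuousLinearMap.HasLeftInverse.of_injective_of_finiteDimensional hinj)
    (ha.congr_of_eventuallyEq hBc), hc.mono fun q hq ↦ hq.symm⟩

lemma differentiableAt_bilinearComp
    {V' W' Z : Type*} [NormedAddCommGroup V'] [NormedSpace 𝕜 V']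
    [NormedAddCommGroup W'] [NormedSpace 𝕜 W'] [NormedAddCommGroup Z] [NormedSpace 𝕜 Z]
    {G : X → V →L[𝕜] W →L[𝕜] Z} {S : X → V' →L[𝕜] V} {T : X → W' →L[𝕜] W} {p : X}
    (hG : DifferentiableAt 𝕜 G p) (hS : DifferentiableAt 𝕜 S p) (hT : DifferentiableAt 𝕜 T p) :
    DifferentiableAt 𝕜 (fun q ↦ (G q).bilinearComp (S q) (T q)) p := by
  have hprecomp : DifferentiableAt 𝕜 (fun q ↦ (ContinuousLinearMap.compL 𝕜 W' W Z).flip (T q)) p :=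
    (ContinuousLinearMap.compL 𝕜 W' W Z).flip.differentiableAt.comp p hT
  exact hprecomp.clm_comp (hG.clm_comp hS)

lemma fderiv_clm_apply₂ {Z : Type*} [NormedAddCommGroup Z] [NormedSpace 𝕜 Z]
    {G : X → V →L[𝕜] W →L[𝕜] Z} {Y : X → V} {Y' : X → W} {p : X}
    (hG : DifferentiableAt 𝕜 G p) (hY : DifferentiableAt 𝕜 Y p) (hY' : DifferentiableAt 𝕜 Y' p)
    (z : X) :
    fderiv 𝕜 (fun q ↦ G q (Y q) (Y' q)) p z
      = fderiv 𝕜 G p z (Y p) (Y' p) + G p (fderiv 𝕜 Y p z) (Y' p)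
        + G p (Y p) (fderiv 𝕜 Y' p z) := by
  rw [fderiv_clm_apply (hG.clm_apply hY) hY', fderiv_clm_apply hG hY]
  simp [add_comm]

end Calculus

section NondegenerateForm

variable {E E' : Type*} [NormedAddCommGroup E] [NormedSpace ℝ E]
  [NormedAddCommGroup E'] [NormedSpace ℝ E'] {B' : E' →L[ℝ] E' →L[ℝ] ℝ}

lemma eq_of_nondegenerate (hB' : ∀ u, (∀ w, B' u w = 0) → u = 0) {u v : E'}
    (huv : ∀ w, B' u w = B' v w) : u = v :=
  sub_eq_zero.1 (hB' _ fun w ↦ by rw [map_sub, sub_apply, huv, sub_self])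

lemma exists_adjoint_of_nondegenerate [FiniteDimensional ℝ E']
    (hB' : ∀ u, (∀ w, B' u w = 0) → u = 0) (B : E →L[ℝ] E →L[ℝ] ℝ) (T : E' →L[ℝ] E) :
    ∃ R : E →L[ℝ] E', ∀ e w, B' (R e) w = B e (T w) := by
  have hinj : Function.Injective B' := fun u v huv ↦ eq_of_nondegenerate hB' fun w ↦ congr($huv w)
  have hfinrank : Module.finrank ℝ E' = Module.finrank ℝ (E' →L[ℝ] ℝ) :=
    Subspace.dual_finrank_eq.symm.trans (LinearMap.toContinuousLinearMap (E := E')).finrank_eq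
  have hsurj : Function.Surjective B' :=
    (LinearMap.injective_iff_surjective_of_finrank_eq_finrank (f := B'.toLinearMap) hfinrank).1 hinj
  obtain ⟨s, hs⟩ :=
    ContinuousLinearMap.HasRightInverse.of_surjective_of_finiteDimensional hsurj
  exact ⟨s ∘L (ContinuousLinearMap.compL ℝ E' E ℝ).flip T ∘L B, fun e w ↦ congr($(hs (B e ∘L T)) w)⟩

lemma leftInverse_of_adjoint_of_isometry {B : E →L[ℝ] E →L[ℝ] ℝ} {T : E' →L[ℝ] E}
    {R : E →L[ℝ] E'} (hB' : ∀ u, (∀ w, B' u w = 0) → u = 0)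
    (hR : ∀ e w, B' (R e) w = B e (T w)) (hT : ∀ v w, B (T v) (T w) = B' v w) :
    Function.LeftInverse R T :=
  fun v ↦ eq_of_nondegenerate hB' fun w ↦ (hR _ _).trans (hT v w)

lemma adjoint_apply_of_skew {B : E →L[ℝ] E →L[ℝ] ℝ} {T : E' →L[ℝ] E} {R : E →L[ℝ] E'}
    {J : E →L[ℝ] E} {J' : E' →L[ℝ] E'}
    (hB' : ∀ u, (∀ w, B' u w = 0) → u = 0) (hR : ∀ e w, B' (R e) w = B e (T w))
    (hJ : ∀ e e', B (J e) e' = -B e (J e')) (hJ' : ∀ v w, B' (J' v) w = -B' v (J' w))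
    (hJT : ∀ w, J (T w) = T (J' w)) (e : E) : R (J e) = J' (R e) :=
  eq_of_nondegenerate hB' fun w ↦ by rw [hR, hJ, hJT, hJ', hR]

end NondegenerateForm

section AlongMap

variable {F E E' : Type*} [NormedAddCommGroup F] [NormedSpace ℝ F]
  [NormedAddCommGroup E'] [NormedSpace ℝ E'] [NormedAddCommGroup E] [NormedSpace ℝ E]

/-- In a chart, the covariant derivative at `p` in the direction `z` of a vector field `Y` along a
map `i`; here `Γ` is the value at `i p` of the Christoffel symbols of the connection. In `Γ Y v` the
first argument is the field and the second one the direction of differentiation. -/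
def covDerivAlong (Γ : E →L[ℝ] E →L[ℝ] E) (i : F → E) (Y : F → E) (p z : F) : E :=
  fderiv ℝ Y p z + Γ (Y p) (fderiv ℝ i p z)

/-- In a chart, the covariant derivative at `x` in the direction `v` of a field `A` of
endomorphisms; here `Γ` is the value at `x` of the Christoffel symbols. -/
def covDerivEnd (Γ : E →L[ℝ] E →L[ℝ] E) (A : E → E →L[ℝ] E) (x v : E) : E →L[ℝ] E :=
  fderiv ℝ A x v + Γ.flip v ∘L A x - A x ∘L Γ.flip v

/-- `Γ` is the value at `x` of the Christoffel symbols of the Levi-Civita connection of `G`: it is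
symmetric, and the covariant derivative of `G` at `x` vanishes. -/
structure IsLeviCivitaSymbol (G : E → E →L[ℝ] E →L[ℝ] ℝ) (x : E) (Γ : E →L[ℝ] E →L[ℝ] E) :
    Prop where
  symm (u v : E) : Γ u v = Γ v u
  metric (v u w : E) : fderiv ℝ G x v u w = G x (Γ u v) w + G x u (Γ w v)

variable {Γ : E →L[ℝ] E →L[ℝ] E} {i : F → E} {p : F}

lemma covDerivEnd_apply (A : E → E →L[ℝ] E) (x v u : E) :
    covDerivEnd Γ A x v u = fderiv ℝ A x v u + Γ (A x u) v - A x (Γ u v) := rfl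

lemma covDerivAlong_congr {Y Z : F → E} (h : Y =ᶠ[𝓝 p] Z) (z : F) :
    covDerivAlong Γ i Y p z = covDerivAlong Γ i Z p z := by
  rw [covDerivAlong, covDerivAlong, h.fderiv_eq, h.self_of_nhds]

lemma covDerivAlong_sum_smul {n : Type*} [Fintype n] {c : F → n → ℝ} {Y : n → F → E}
    (hc : DifferentiableAt ℝ c p) (hY : ∀ β, DifferentiableAt ℝ (Y β) p) (z : F) :
    covDerivAlong Γ i (fun q ↦ ∑ β, c q β • Y β q) p z
      = ∑ β, (fderiv ℝ c p z β • Y β p + c p β • covDerivAlong Γ i (Y β) p z) := by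
  have hcβ (β : n) : DifferentiableAt ℝ (fun q ↦ c q β) p := differentiableAt_pi.1 hc β
  have hfderiv (β : n) : fderiv ℝ (fun q ↦ c q β • Y β q) p z
      = fderiv ℝ c p z β • Y β p + c p β • fderiv ℝ (Y β) p z := by
    rw [fderiv_fun_smul (hcβ β) (hY β), fderiv_apply hc]
    simp [add_comm]
  rw [covDerivAlong, fderiv_fun_sum fun β _ ↦ (hcβ β).fun_smul (hY β)]
  simp only [covDerivAlong, sum_apply, hfderiv, map_sum, map_smul, smul_apply,
    ← Finset.sum_add_distrib, smul_add, add_assoc]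

lemma covDerivAlong_clm_apply {S : F → E' →L[ℝ] E} {a : F → E'}
    (hS : DifferentiableAt ℝ S p) (ha : DifferentiableAt ℝ a p) (z : F) :
    covDerivAlong Γ i (fun q ↦ S q (a q)) p z
      = covDerivAlong Γ i (fun q ↦ S q (a p)) p z + S p (fderiv ℝ a p z) := by
  simp only [covDerivAlong, fderiv_clm_apply hS ha, fderiv_clm_apply hS (differentiableAt_const _)]
  simp
  abel

lemma covDerivAlong_end_apply {A : E → E →L[ℝ] E} {Y : F → E}
    (hA : DifferentiableAt ℝ A (i p)) (hi : DifferentiableAt ℝ i p) (hY : DifferentiableAt ℝ Y p)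
    (z : F) :
    covDerivAlong Γ i (fun q ↦ A (i q) (Y q)) p z
      = covDerivEnd Γ A (i p) (fderiv ℝ i p z) (Y p) + A (i p) (covDerivAlong Γ i Y p z) := by
  have hfderiv : fderiv ℝ (fun q ↦ A (i q) (Y q)) p z
      = fderiv ℝ A (i p) (fderiv ℝ i p z) (Y p) + A (i p) (fderiv ℝ Y p z) := by
    rw [fderiv_clm_apply (c := fun q ↦ A (i q)) (hA.comp p hi) hY, fderiv_fun_comp p hA hi]
    simp [add_comm]
  rw [covDerivEnd_apply, covDerivAlong, covDerivAlong, hfderiv, map_add]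
  abel

lemma IsLeviCivitaSymbol.fderiv_apply_along {G : E → E →L[ℝ] E →L[ℝ] ℝ} {Y Z : F → E}
    (hΓ : IsLeviCivitaSymbol G (i p) Γ) (hG : DifferentiableAt ℝ G (i p))
    (hi : DifferentiableAt ℝ i p) (hY : DifferentiableAt ℝ Y p) (hZ : DifferentiableAt ℝ Z p)
    (z : F) :
    fderiv ℝ (fun q ↦ G (i q) (Y q) (Z q)) p z
      = G (i p) (covDerivAlong Γ i Y p z) (Z p) + G (i p) (Y p) (covDerivAlong Γ i Z p z) := by
  rw [fderiv_clm_apply₂ (G := fun q ↦ G (i q)) (hG.comp p hi) hY hZ, fderiv_fun_comp p hG hi,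
    ContinuousLinearMap.comp_apply, hΓ.metric]
  simp only [covDerivAlong, map_add, add_apply]
  ring

/-- The absence of torsion, seen along `i`: the right-hand side is `di [l v, l u]`. -/
lemma covDerivAlong_fderiv_sub_comm (hΓ : ∀ u v, Γ u v = Γ v u) (hi : ContDiffAt ℝ 2 i p)
    {l : F → E' →L[ℝ] F} (hl : DifferentiableAt ℝ l p) (u v : E') :
    covDerivAlong Γ i (fun q ↦ fderiv ℝ i q (l q u)) p (l p v)
        - covDerivAlong Γ i (fun q ↦ fderiv ℝ i q (l q v)) p (l p u)
      = fderiv ℝ i p (fderiv ℝ l p (l p v) u - fderiv ℝ l p (l p u) v) := by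
  have hdi : DifferentiableAt ℝ (fderiv ℝ i) p :=
    (hi.fderiv_right (m := 1) (by norm_num)).differentiableAt one_ne_zero
  have hfderiv (w : E') (z : F) : fderiv ℝ (fun q ↦ fderiv ℝ i q (l q w)) p z
      = fderiv ℝ (fderiv ℝ i) p z (l p w) + fderiv ℝ i p (fderiv ℝ l p z w) := by
    rw [fderiv_clm_apply hdi (hl.clm_apply (differentiableAt_const w)),
      fderiv_clm_apply hl (differentiableAt_const w)]
    simp [add_comm]
  rw [covDerivAlong, covDerivAlong, hfderiv, hfderiv, hΓ (fderiv ℝ i p (l p u)),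
    hi.isSymmSndFDerivAt (by simp) (l p v) (l p u), map_sub]
  abel

end AlongMap

section HorizontalLift

variable {F E E' : Type*} [NormedAddCommGroup F] [NormedSpace ℝ F]
  [NormedAddCommGroup E'] [NormedSpace ℝ E'] [NormedAddCommGroup E] [NormedSpace ℝ E]

/-- Near `p`, the field `l` lifts tangent vectors of the target of `f` horizontally: `l q` is a
section of `df` and the adjoint of `df`, for the form `G'` on the target and the form that `i`
induces from `G` on the source. -/
structure IsLocalHorizontalLift (i : F → E) (f : F → E') (l : F → E' →L[ℝ] F)
    (G : E → E →L[ℝ] E →L[ℝ] ℝ) (G' : E' → E' →L[ℝ] E' →L[ℝ] ℝ) (p : F) : Prop where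
  contDiffAt_inclusion : ContDiffAt ℝ 2 i p
  contDiffAt_submersion : ContDiffAt ℝ 2 f p
  differentiableAt : DifferentiableAt ℝ l p
  isSection : ∀ᶠ q in 𝓝 p, ∀ w, fderiv ℝ f q (l q w) = w
  adjoint : ∀ᶠ q in 𝓝 p, ∀ w u,
    G (i q) (fderiv ℝ i q (l q w)) (fderiv ℝ i q u) = G' (f q) w (fderiv ℝ f q u)

/-- The horizontal lift `l`, pushed forward to the ambient space by `i`. -/
def ambientLift (i : F → E) (l : F → E' →L[ℝ] F) (q : F) : E' →L[ℝ] E := fderiv ℝ i q ∘L l q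

/-- The Christoffel symbols obtained by projecting with `R` the ambient covariant derivatives, in
the directions `l p v`, of the horizontal lifts of constant fields. -/
def projectedSymbol (R : E →L[ℝ] E') (Γ : E →L[ℝ] E →L[ℝ] E) (i : F → E) (l : F → E' →L[ℝ] F)
    (p : F) : E' →L[ℝ] E' →L[ℝ] E' :=
  ContinuousLinearMap.compL ℝ E' E E' R ∘L ((fderiv ℝ (ambientLift i l) p ∘L l p).flip
    + Γ.bilinearComp (ambientLift i l p) (ambientLift i l p))

variable {i : F → E} {f : F → E'} {l : F → E' →L[ℝ] F} {G : E → E →L[ℝ] E →L[ℝ] ℝ}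
  {G' : E' → E' →L[ℝ] E' →L[ℝ] ℝ} {p : F}

lemma differentiableAt_of_adjoint_fderiv [FiniteDimensional ℝ F]
    (hi : ContDiffAt ℝ 2 i p) (hf : ContDiffAt ℝ 2 f p) (hG : DifferentiableAt ℝ G (i p))
    (hG' : DifferentiableAt ℝ G' (f p))
    (hnondeg : ∀ u, (∀ w, G (i p) (fderiv ℝ i p u) (fderiv ℝ i p w) = 0) → u = 0)
    (hadjoint : ∀ᶠ q in 𝓝 p, ∀ w u,
      G (i q) (fderiv ℝ i q (l q w)) (fderiv ℝ i q u) = G' (f q) w (fderiv ℝ f q u)) :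
    DifferentiableAt ℝ l p := by
  let H (q : F) : F →L[ℝ] F →L[ℝ] ℝ := (G (i q)).bilinearComp (fderiv ℝ i q) (fderiv ℝ i q)
  let K (q : F) : E' →L[ℝ] F →L[ℝ] ℝ :=
    (G' (f q)).bilinearComp (ContinuousLinearMap.id ℝ E') (fderiv ℝ f q)
  have hdi : DifferentiableAt ℝ (fderiv ℝ i) p :=
    (hi.fderiv_right (m := 1) le_rfl).differentiableAt one_ne_zero
  have hdf : DifferentiableAt ℝ (fderiv ℝ f) p :=
    (hf.fderiv_right (m := 1) le_rfl).differentiableAt one_ne_zero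
  have hH : DifferentiableAt ℝ H p := differentiableAt_bilinearComp
    (hG.comp p (hi.differentiableAt two_ne_zero)) hdi hdi
  have hK : DifferentiableAt ℝ K p := differentiableAt_bilinearComp
    (hG'.comp p (hf.differentiableAt two_ne_zero)) (differentiableAt_const _) hdf
  have hHl : (fun q ↦ ContinuousLinearMap.compL ℝ E' F (F →L[ℝ] ℝ) (H q) (l q)) =ᶠ[𝓝 p] K := by
    filter_upwards [hadjoint] with q hq
    ext w u
    exact hq w u
  have hinj : Function.Injective (H p) := (injective_iff_map_eq_zero _).2 fun u hu ↦
    hnondeg u fun w ↦ congr($hu w)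
  obtain ⟨P, hP⟩ := ContinuousLinearMap.HasLeftInverse.of_injective_of_finiteDimensional hinj
  have := FiniteDimensional.complete ℝ F
  exact differentiableAt_of_clm_apply
    ((ContinuousLinearMap.compL ℝ E' F (F →L[ℝ] ℝ)).differentiableAt.comp p hH)
    ⟨ContinuousLinearMap.compL ℝ E' (F →L[ℝ] ℝ) F P, fun T ↦ by ext w; exact hP (T w)⟩
    (hK.congr_of_eventuallyEq hHl)

namespace IsLocalHorizontalLift

lemma differentiableAt_ambientLift (h : IsLocalHorizontalLift i f l G G' p) :
    DifferentiableAt ℝ (ambientLift i l) p :=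
  ((h.contDiffAt_inclusion.fderiv_right (m := 1) (by norm_num)).differentiableAt
    one_ne_zero).clm_comp h.differentiableAt

lemma projectedSymbol_apply (h : IsLocalHorizontalLift i f l G G' p) (R : E →L[ℝ] E')
    (Γ : E →L[ℝ] E →L[ℝ] E) (u v : E') :
    projectedSymbol R Γ i l p u v
      = R (covDerivAlong Γ i (fun q ↦ ambientLift i l q u) p (l p v)) := by
  rw [covDerivAlong, fderiv_clm_apply h.differentiableAt_ambientLift (differentiableAt_const u)]
  simp [projectedSymbol, ambientLift]

lemma isometry (h : IsLocalHorizontalLift i f l G G' p) : ∀ᶠ q in 𝓝 p, ∀ u w,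
    G (i q) (ambientLift i l q u) (ambientLift i l q w) = G' (f q) u w := by
  filter_upwards [h.adjoint, h.isSection] with q hadj hsec u w
  exact (hadj u (l q w)).trans (by rw [hsec])

lemma fderiv_bracket_eq_zero (h : IsLocalHorizontalLift i f l G G' p) (u v : E') :
    fderiv ℝ f p (fderiv ℝ l p (l p v) u - fderiv ℝ l p (l p u) v) = 0 := by
  have hconst (w : E') (z : F) : covDerivAlong 0 f (fun q ↦ fderiv ℝ f q (l q w)) p z = 0 := by
    rw [covDerivAlong_congr (h.isSection.mono fun q hq ↦ hq w)]
    simp [covDerivAlong]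
  rw [← covDerivAlong_fderiv_sub_comm (Γ := 0) (fun _ _ ↦ rfl) h.contDiffAt_submersion
    h.differentiableAt, hconst, hconst, sub_zero]

variable {R : E →L[ℝ] E'} {Γ : E →L[ℝ] E →L[ℝ] E}

theorem isLeviCivitaSymbol (h : IsLocalHorizontalLift i f l G G' p)
    (hG : DifferentiableAt ℝ G (i p)) (hG' : DifferentiableAt ℝ G' (f p))
    (hG_symm : ∀ u w, G (i p) u w = G (i p) w u)
    (hG'_symm : ∀ u w, G' (f p) u w = G' (f p) w u)
    (hG'_nondeg : ∀ u, (∀ w, G' (f p) u w = 0) → u = 0)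
    (hR : ∀ e w, G' (f p) (R e) w = G (i p) e (ambientLift i l p w))
    (hΓ : IsLeviCivitaSymbol G (i p) Γ) :
    IsLeviCivitaSymbol G' (f p) (projectedSymbol R Γ i l p) where
  symm u v := by
    refine eq_of_nondegenerate hG'_nondeg fun x ↦ sub_eq_zero.1 ?_
    rw [h.projectedSymbol_apply, h.projectedSymbol_apply, hR, hR, ← sub_apply, ← map_sub]
    simp only [ambientLift, ContinuousLinearMap.comp_apply]
    rw [covDerivAlong_fderiv_sub_comm hΓ.symm h.contDiffAt_inclusion h.differentiableAt, hG_symm,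
      h.adjoint.self_of_nhds, h.fderiv_bracket_eq_zero, map_zero]
  metric v u w := by
    have hL (w : E') : DifferentiableAt ℝ (fun q ↦ ambientLift i l q w) p :=
      h.differentiableAt_ambientLift.clm_apply (differentiableAt_const w)
    have hf := h.contDiffAt_submersion.differentiableAt two_ne_zero
    have hbase : fderiv ℝ (fun q ↦ G' (f q) u w) p (l p v) = fderiv ℝ G' (f p) v u w := by
      rw [fderiv_clm_apply₂ (G := fun q ↦ G' (f q)) (hG'.comp p hf) (differentiableAt_const u)
        (differentiableAt_const w), fderiv_fun_comp p hG' hf]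
      simp [h.isSection.self_of_nhds v]
    have hambient := hΓ.fderiv_apply_along hG
      (h.contDiffAt_inclusion.differentiableAt two_ne_zero) (hL u) (hL w) (l p v)
    have hisometry : (fun q ↦ G (i q) (ambientLift i l q u) (ambientLift i l q w))
        =ᶠ[𝓝 p] fun q ↦ G' (f q) u w := h.isometry.mono fun q hq ↦ hq u w
    rw [← hbase, ← hisometry.fderiv_eq, hambient, h.projectedSymbol_apply,
      h.projectedSymbol_apply, hR, hG'_symm u, hR, hG_symm (ambientLift i l p u)]

lemma covDerivEnd_projectedSymbol {n : Type*} [Fintype n] {J : n → E → E →L[ℝ] E}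
    {J' : n → E' →L[ℝ] E'} {A : E' → E' →L[ℝ] E'} {c : F → n → ℝ}
    (h : IsLocalHorizontalLift i f l G G' p) (hJ : ∀ β, DifferentiableAt ℝ (J β) (i p))
    (hJL : ∀ β w, J β (i p) (ambientLift i l p w) = ambientLift i l p (J' β w))
    (hRL : ∀ w, R (ambientLift i l p w) = w) (hRJ : ∀ β e, R (J β (i p) e) = J' β (R e))
    (hA : DifferentiableAt ℝ A (f p)) (hc : DifferentiableAt ℝ c p)
    (hlift : ∀ᶠ q in 𝓝 p, ∀ w,
      ambientLift i l q (A (f q) w) = ∑ β, c q β • J β (i q) (ambientLift i l q w)) (v : E') :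
    covDerivEnd (projectedSymbol R Γ i l p) A (f p) v
      = ∑ β, (fderiv ℝ c p (l p v) β • J' β
          + c p β • R ∘L covDerivEnd Γ (J β) (i p) (ambientLift i l p v) ∘L ambientLift i l p) := by
  have hi := h.contDiffAt_inclusion.differentiableAt two_ne_zero
  have hf := h.contDiffAt_submersion.differentiableAt two_ne_zero
  have hL := h.differentiableAt_ambientLift
  have hLw (w : E') : DifferentiableAt ℝ (fun q ↦ ambientLift i l q w) p :=
    hL.clm_apply (differentiableAt_const w)
  have hdi : fderiv ℝ i p (l p v) = ambientLift i l p v := rfl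
  have hA_eq (w : E') : A (f p) w = ∑ β, c p β • J' β w := by
    simpa only [map_sum, map_smul, hJL, hRL] using congr(R $(hlift.self_of_nhds w))
  have hAf (w : E') : fderiv ℝ (fun q ↦ A (f q) w) p (l p v) = fderiv ℝ A (f p) v w := by
    rw [fderiv_clm_apply (c := fun q ↦ A (f q)) (hA.comp p hf) (differentiableAt_const w),
      fderiv_fun_comp p hA hf]
    simp [h.isSection.self_of_nhds v]
  ext w
  have hprojected : projectedSymbol R Γ i l p (A (f p) w) v + fderiv ℝ A (f p) v w
      = ∑ β, (fderiv ℝ c p (l p v) β • J' β w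
        + c p β • (R (covDerivEnd Γ (J β) (i p) (ambientLift i l p v) (ambientLift i l p w))
          + J' β (projectedSymbol R Γ i l p w v))) := by
    have hcov := congr(R $(covDerivAlong_congr (Γ := Γ) (i := i)
      (hlift.mono fun q hq ↦ hq w) (l p v)))
    rw [covDerivAlong_clm_apply (a := fun q ↦ A (f q) w) hL
        ((hA.comp p hf).clm_apply (differentiableAt_const w)),
      covDerivAlong_sum_smul (Y := fun β q ↦ J β (i q) (ambientLift i l q w)) hc
        fun β ↦ ((hJ β).comp p hi).clm_apply (hLw w)] at hcov
    simpa only [covDerivAlong_end_apply (hJ _) hi (hLw w), map_add, map_sum, map_smul, hRL, hRJ,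
      hAf, hdi, Function.comp_apply, ← h.projectedSymbol_apply] using hcov
  rw [covDerivEnd_apply, hA_eq (projectedSymbol R Γ i l p w v), add_comm, hprojected,
    ← Finset.sum_sub_distrib, sum_apply]
  refine Finset.sum_congr rfl fun β _ ↦ ?_
  simp only [add_apply, smul_apply, ContinuousLinearMap.comp_apply]
  module

theorem covDerivEnd_mem_span [FiniteDimensional ℝ E] [FiniteDimensional ℝ E']
    {n : Type*} [Finite n] {J : n → E → E →L[ℝ] E} {J' : n → E' →L[ℝ] E'}
    {A : E' → E' →L[ℝ] E'} (h : IsLocalHorizontalLift i f l G G' p)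
    (hJ : ∀ β, DifferentiableAt ℝ (J β) (i p))
    (hJ_parallel : ∀ β v,
      covDerivEnd Γ (J β) (i p) v ∈ Submodule.span ℝ (Set.range fun γ ↦ J γ (i p)))
    (hJL : ∀ β w, J β (i p) (ambientLift i l p w) = ambientLift i l p (J' β w))
    (hRL : ∀ w, R (ambientLift i l p w) = w) (hRJ : ∀ β e, R (J β (i p) e) = J' β (R e))
    (hJ'_indep : LinearIndependent ℝ J') (hA : DifferentiableAt ℝ A (f p))
    (hlift : ∀ᶠ q in 𝓝 p, ambientLift i l q ∘L A (f q)
      ∈ Submodule.span ℝ (Set.range fun β ↦ J β (i q) ∘L ambientLift i l q)) (v : E') :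
    covDerivEnd (projectedSymbol R Γ i l p) A (f p) v ∈ Submodule.span ℝ (Set.range J') := by
  have := Fintype.ofFinite n
  have hL := h.differentiableAt_ambientLift
  have hconj : ∀ B ∈ Submodule.span ℝ (Set.range fun γ ↦ J γ (i p)),
      R ∘L B ∘L ambientLift i l p ∈ Submodule.span ℝ (Set.range J') := by
    let conj := (ContinuousLinearMap.compL ℝ E' E E' R).toLinearMap ∘ₗ
      ((ContinuousLinearMap.compL ℝ E' E E).flip (ambientLift i l p)).toLinearMap
    refine Submodule.span_le (p := (Submodule.span ℝ (Set.range J')).comap conj) |>.2 ?_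
    rintro _ ⟨β, rfl⟩
    refine Submodule.subset_span ⟨β, ?_⟩
    ext w
    simp [conj, hRJ, hRL]
  have hJL_indep : LinearIndependent ℝ fun β ↦ J β (i p) ∘L ambientLift i l p := by
    refine LinearIndependent.of_comp (ContinuousLinearMap.compL ℝ E' E E' R).toLinearMap ?_
    convert hJ'_indep using 1
    ext β w
    simp [hRJ, hRL]
  obtain ⟨c, hc, hAc⟩ := exists_differentiableAt_coeff
    (fun β ↦ ((hJ β).comp p (h.contDiffAt_inclusion.differentiableAt two_ne_zero)).clm_comp hL)
    hJL_indep
    (hL.clm_comp (hA.comp p (h.contDiffAt_submersion.differentiableAt two_ne_zero))) hlift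
  rw [h.covDerivEnd_projectedSymbol hJ hJL hRL hRJ hA hc
    (hAc.mono fun q hq w ↦ by simpa using congr($hq w))]
  exact Submodule.sum_mem _ fun β _ ↦ Submodule.add_mem _
    (Submodule.smul_mem _ _ (Submodule.subset_span (Set.mem_range_self β)))
    (Submodule.smul_mem _ _ (hconj _ (hJ_parallel β _)))

end IsLocalHorizontalLift

end HorizontalLift

section Charts

variable {E : Type*} [NormedAddCommGroup E] [NormedSpace ℝ E]
  {M : Type*} [TopologicalSpace M] [ChartedSpace E M]

/-- The preferred chart at `x`, as a map to the model space. -/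
def coord (x : M) : M → E := extChartAt 𝓘(ℝ, E) x

/-- The inverse of the preferred chart at `x`. -/
def coordInv (x : M) : E → M := (extChartAt 𝓘(ℝ, E) x).symm

@[simp] lemma coordInv_coord {x y : M} (hy : y ∈ (chartAt E x).source) :
    coordInv (E := E) x (coord x y) = y :=
  (extChartAt 𝓘(ℝ, E) x).left_inv (by simpa using hy)

lemma eventually_nhds_coord {x : M} {P : E → Prop} :
    (∀ᶠ e in 𝓝 (coord x x), P e) ↔ ∀ᶠ y in 𝓝 x, P (coord x y) := by
  simp only [coord, ← map_extChartAt_nhds_of_boundaryless (I := 𝓘(ℝ, E)) x, eventually_map]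

lemma mdifferentiableAt_coord [IsManifold 𝓘(ℝ, E) ∞ M] {x y : M} (hy : y ∈ (chartAt E x).source) :
    MDifferentiableAt 𝓘(ℝ, E) 𝓘(ℝ, E) (coord (E := E) x) y :=
  mdifferentiableAt_extChartAt hy

lemma eventuallyEq_comp_coordInv_comp_coord {W : Type*} (u : M → W) (x : M) :
    (u ∘ coordInv (E := E) x) ∘ coord x =ᶠ[𝓝 x] u := by
  filter_upwards [chart_source_mem_nhds E x] with y hy
  simp [hy]

lemma mdifferentiableAt_iff_comp_coordInv [IsManifold 𝓘(ℝ, E) ∞ M]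
    {W : Type*} [NormedAddCommGroup W] [NormedSpace ℝ W] {u : M → W} {x : M} :
    MDifferentiableAt 𝓘(ℝ, E) 𝓘(ℝ, W) u x
      ↔ DifferentiableAt ℝ (u ∘ coordInv x) (coord (E := E) x x) := by
  refine ⟨fun h ↦ ?_, fun h ↦ ?_⟩
  · have hwritten := h.differentiableWithinAt_writtenInExtChartAt
    rwa [ModelWithCorners.range_eq_univ, differentiableWithinAt_univ] at hwritten
  · exact (h.mdifferentiableAt.comp x (mdifferentiableAt_coord (mem_chart_source E x))
      ).congr_of_eventuallyEq (eventuallyEq_comp_coordInv_comp_coord u x).symm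

variable [IsManifold 𝓘(ℝ, E) ∞ M]

/-- The coordinates of tangent vectors at `y` in the preferred chart at `x`; junk unless `y` lies in
the domain of that chart. -/
def toModel (x y : M) : TangentSpace 𝓘(ℝ, E) y →L[ℝ] E :=
  (trivializationAt E (TangentSpace 𝓘(ℝ, E)) x).continuousLinearMapAt ℝ y

/-- The tangent vectors at `y` with given coordinates in the preferred chart at `x`; junk unless `y`
lies in the domain of that chart. -/
def ofModel (x y : M) : E →L[ℝ] TangentSpace 𝓘(ℝ, E) y :=
  (trivializationAt E (TangentSpace 𝓘(ℝ, E)) x).symmL ℝ y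

@[simp] lemma toModel_ofModel {x y : M} (hy : y ∈ (chartAt E x).source) (v : E) :
    toModel x y (ofModel x y v) = v :=
  (trivializationAt E (TangentSpace 𝓘(ℝ, E)) x).continuousLinearMapAt_symmL (R := ℝ) hy v

@[simp] lemma ofModel_toModel {x y : M} (hy : y ∈ (chartAt E x).source)
    (v : TangentSpace 𝓘(ℝ, E) y) : ofModel x y (toModel x y v) = v :=
  (trivializationAt E (TangentSpace 𝓘(ℝ, E)) x).symmL_continuousLinearMapAt (R := ℝ) hy v

lemma toModel_injective (x : M) : Function.Injective (toModel (E := E) x x) :=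
  Function.LeftInverse.injective (ofModel_toModel (mem_chart_source E x))

lemma toModel_eq_mfderiv {x y : M} (hy : y ∈ (chartAt E x).source) :
    toModel x y = mfderiv 𝓘(ℝ, E) 𝓘(ℝ, E) (coord (E := E) x) y :=
  TangentBundle.continuousLinearMapAt_trivializationAt (I := 𝓘(ℝ, E)) hy

lemma inverse_ofModel {x y : M} (hy : y ∈ (chartAt E x).source) :
    (ofModel (E := E) x y).inverse = toModel x y :=
  ContinuousLinearMap.inverse_eq (ContinuousLinearMap.ext (ofModel_toModel hy))
    (ContinuousLinearMap.ext (toModel_ofModel hy))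

lemma inverse_toModel {x y : M} (hy : y ∈ (chartAt E x).source) :
    (toModel (E := E) x y).inverse = ofModel x y :=
  ContinuousLinearMap.inverse_eq (ContinuousLinearMap.ext (toModel_ofModel hy))
    (ContinuousLinearMap.ext (ofModel_toModel hy))

lemma mvfderiv_eq_fderiv_comp_coordInv {W : Type*} [NormedAddCommGroup W] [NormedSpace ℝ W]
    {u : M → W} {x : M} (hu : MDifferentiableAt 𝓘(ℝ, E) 𝓘(ℝ, W) u x)
    (v : TangentSpace 𝓘(ℝ, E) x) :
    (d% u x) v = fderiv ℝ (u ∘ coordInv x) (coord x x) (toModel x x v) := by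
  have hchain := mfderiv_comp (I := 𝓘(ℝ, E)) (I' := 𝓘(ℝ, E)) (I'' := 𝓘(ℝ, W)) x
    (mdifferentiableAt_iff_comp_coordInv.1 hu).mdifferentiableAt
    (mdifferentiableAt_coord (mem_chart_source E x))
  rw [(eventuallyEq_comp_coordInv_comp_coord u x).mfderiv_eq, mfderiv_eq_fderiv] at hchain
  rw [toModel_eq_mfderiv (mem_chart_source E x)]
  exact congr($hchain v)

section VectorField

/-- The coordinate expression of a vector field in the preferred chart at `x`. -/
def coordField (x : M) (Y : ∀ y : M, TangentSpace 𝓘(ℝ, E) y) (e : E) : E :=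
  toModel x (coordInv x e) (Y (coordInv x e))

@[simp] lemma coordField_coord {x y : M} (hy : y ∈ (chartAt E x).source)
    (Y : ∀ y : M, TangentSpace 𝓘(ℝ, E) y) : coordField x Y (coord x y) = toModel x y (Y y) :=
  congrArg (fun z ↦ toModel x z (Y z)) (coordInv_coord hy)

lemma coordField_add (x : M) (Y Z : ∀ y : M, TangentSpace 𝓘(ℝ, E) y) :
    coordField x (Y + Z) = coordField x Y + coordField x Z :=
  funext fun e ↦ map_add (toModel x (coordInv x e)) _ _

lemma coordField_smul (x : M) (u : M → ℝ) (Y : ∀ y : M, TangentSpace 𝓘(ℝ, E) y) :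
    coordField x (u • Y) = (u ∘ coordInv (E := E) x) • coordField x Y :=
  funext fun e ↦ map_smul (toModel x (coordInv x e)) _ _

lemma mdifferentiableAt_iff_coordField {x : M} {Y : ∀ y : M, TangentSpace 𝓘(ℝ, E) y} :
    MDiffAt (T% Y) x ↔ DifferentiableAt ℝ (coordField x Y) (coord x x) := by
  rw [mdifferentiableAt_section, mdifferentiableAt_iff_comp_coordInv]
  refine Filter.EventuallyEq.differentiableAt_iff (eventually_nhds_coord.2 ?_)
  filter_upwards [chart_source_mem_nhds E x] with y hy
  rw [coordField_coord hy, Function.comp_apply, coordInv_coord hy]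
  exact congr($(Bundle.Trivialization.coe_linearMapAt_of_mem (R := ℝ) (b := y)
    (trivializationAt E (TangentSpace 𝓘(ℝ, E)) x) hy) (Y y)).symm

/-- The vector field with constant coordinates `u` in the preferred chart at `x`. -/
def constField (x : M) (u : E) (y : M) : TangentSpace 𝓘(ℝ, E) y := ofModel x y u

lemma coordField_constField (x : M) (u : E) :
    coordField x (constField x u) =ᶠ[𝓝 (coord x x)] fun _ ↦ u := by
  refine eventually_nhds_coord.2 ?_
  filter_upwards [chart_source_mem_nhds E x] with y hy
  simp [hy, constField]

lemma mdifferentiableAt_constField (x : M) (u : E) : MDiffAt (T% (constField x u)) x :=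
  mdifferentiableAt_iff_coordField.2
    ((differentiableAt_const u).congr_of_eventuallyEq (coordField_constField x u))

lemma mpullbackWithin_coordInv (x : M) (X : ∀ y : M, TangentSpace 𝓘(ℝ, E) y) :
    VectorField.mpullbackWithin 𝓘(ℝ, E) 𝓘(ℝ, E) (coordInv x) X Set.univ
      =ᶠ[𝓝 (coord (E := E) x x)] coordField x X := by
  have hsource : ∀ᶠ e in 𝓝 (coord (E := E) x x),
      coordInv x e ∈ (chartAt E x).source ∧ coord x (coordInv x e) = e := by
    refine eventually_nhds_coord.2 ?_
    filter_upwards [chart_source_mem_nhds E x] with y hy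
    simp [hy]
  filter_upwards [hsource] with e ⟨he, hright⟩
  have hsymm := TangentBundle.symmL_trivializationAt (I := 𝓘(ℝ, E)) he
  rw [show extChartAt 𝓘(ℝ, E) x (coordInv x e) = e from hright,
    ModelWithCorners.range_eq_univ] at hsymm
  have hofModel : @Eq (E →L[ℝ] TangentSpace 𝓘(ℝ, E) (coordInv (E := E) x e))
      (ofModel x (coordInv x e)) (mfderivWithin 𝓘(ℝ, E) 𝓘(ℝ, E) (coordInv x) Set.univ e) := hsymm
  have hinverse := congr($(inverse_ofModel he) (X (coordInv x e)))
  rwa [hofModel] at hinverse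

lemma toModel_mlieBracket [CompleteSpace E] (x : M) (X Y : ∀ y : M, TangentSpace 𝓘(ℝ, E) y) :
    toModel x x (VectorField.mlieBracket 𝓘(ℝ, E) X Y x)
      = fderiv ℝ (coordField x Y) (coord x x) (toModel x x (X x))
        - fderiv ℝ (coordField x X) (coord x x) (toModel x x (Y x)) := by
  have hx := mem_chart_source E x
  let V (Z : ∀ y : M, TangentSpace 𝓘(ℝ, E) y) : E → E :=
    VectorField.mpullbackWithin 𝓘(ℝ, E) 𝓘(ℝ, E) (coordInv x) Z (Set.range 𝓘(ℝ, E))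
  have hbracket : VectorField.mlieBracket 𝓘(ℝ, E) X Y x = (toModel x x).inverse
      (VectorField.lieBracketWithin ℝ (V X) (V Y) (Set.univ ∩ Set.range 𝓘(ℝ, E)) (coord x x)) := by
    rw [toModel_eq_mfderiv hx]
    rfl
  have hV (Z : ∀ y : M, TangentSpace 𝓘(ℝ, E) y) : V Z =ᶠ[𝓝 (coord x x)] coordField x Z := by
    simpa only [V, ModelWithCorners.range_eq_univ] using mpullbackWithin_coordInv x Z
  rw [hbracket, inverse_toModel hx, toModel_ofModel hx, ModelWithCorners.range_eq_univ,
    Set.univ_inter, VectorField.lieBracketWithin_univ, (hV X).lieBracket_vectorField_eq (hV Y),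
    VectorField.lieBracket, coordField_coord hx, coordField_coord hx]

end VectorField

section Endomorphism

variable {A : ∀ y : M, TangentSpace 𝓘(ℝ, E) y →L[ℝ] TangentSpace 𝓘(ℝ, E) y}

/-- The coordinate expression of an endomorphism field in the preferred chart at `x`. -/
def coordEnd (x : M) (A : ∀ y : M, TangentSpace 𝓘(ℝ, E) y →L[ℝ] TangentSpace 𝓘(ℝ, E) y) (e : E) :
    E →L[ℝ] E :=
  toModel x (coordInv x e) ∘L A (coordInv x e) ∘L ofModel x (coordInv x e)

@[simp] lemma coordEnd_coord {x y : M} (hy : y ∈ (chartAt E x).source) :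
    coordEnd x A (coord x y) = toModel x y ∘L A y ∘L ofModel x y :=
  congrArg (fun z ↦ toModel x z ∘L A z ∘L ofModel x z) (coordInv_coord hy)

lemma differentiableAt_coordEnd {x : M} {U : Set M} (hA : SmoothEndOn A U) (hU : IsOpen U)
    (hx : x ∈ U) : DifferentiableAt ℝ (coordEnd x A) (coord x x) := by
  have hA' := (hA.contMDiffAt (hU.mem_nhds hx)).mdifferentiableAt (by simp)
  exact mdifferentiableAt_iff_comp_coordInv.1 ((mdifferentiableAt_hom_bundle _).1 hA').2

lemma coordField_apply_coordEnd (x : M) (Y : ∀ y : M, TangentSpace 𝓘(ℝ, E) y) :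
    coordField x (fun y ↦ A y (Y y))
      =ᶠ[𝓝 (coord x x)] fun e ↦ coordEnd x A e (coordField x Y e) := by
  refine eventually_nhds_coord.2 ?_
  filter_upwards [chart_source_mem_nhds E x] with y hy
  simp [hy]

end Endomorphism

namespace SemiRiemannianMetric

variable (g : SemiRiemannianMetric E M) {x : M}

/-- The coordinate expression of a metric in the preferred chart at `x`. -/
def coordForm (x : M) (e : E) : E →L[ℝ] E →L[ℝ] ℝ :=
  ContinuousLinearMap.precomp ℝ (ofModel x (coordInv x e)) ∘L g.inner (coordInv x e) ∘L
    ofModel x (coordInv x e)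

@[simp] lemma coordForm_coord {y : M} (hy : y ∈ (chartAt E x).source) (u w : E) :
    g.coordForm x (coord x y) u w = g.inner y (ofModel x y u) (ofModel x y w) :=
  congrArg (fun z ↦ g.inner z (ofModel x z u) (ofModel x z w)) (coordInv_coord hy)

lemma coordForm_symm (u w : E) :
    g.coordForm x (coord x x) u w = g.coordForm x (coord x x) w u := by
  simp [g.symm x (ofModel x x u)]

lemma coordForm_nondegenerate (u : E) (hu : ∀ w, g.coordForm x (coord x x) u w = 0) : u = 0 := by
  have hofModel : ofModel x x u = 0 :=
    g.nondegenerate x _ fun w ↦ by simpa using hu (toModel x x w)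
  rw [← toModel_ofModel (mem_chart_source E x) u, hofModel, map_zero]

lemma differentiableAt_coordForm : DifferentiableAt ℝ (g.coordForm x) (coord x x) := by
  have hg := ((mdifferentiableAt_hom_bundle _).1 ((g.contMDiff x).mdifferentiableAt (by simp))).2
  refine (mdifferentiableAt_iff_comp_coordInv.1 hg).congr_of_eventuallyEq
    (eventually_nhds_coord.2 ?_)
  filter_upwards [chart_source_mem_nhds E x] with y hy
  rw [Function.comp_apply, coordInv_coord hy]
  ext u w
  have hofModel (v : E) :
      ofModel x y v = (trivializationAt E (TangentSpace 𝓘(ℝ, E)) x).symm y v :=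
    (trivializationAt E (TangentSpace 𝓘(ℝ, E)) x).symmL_apply (R := ℝ) hy v
  rw [coordForm_coord g hy, hofModel, hofModel]
  refine Eq.trans ?_ (inCoordinates_apply_eq₂ (𝕜 := ℝ) (F₁ := E)
    (E₁ := fun y : M ↦ TangentSpace 𝓘(ℝ, E) y) (F₂ := E) (E₂ := fun y : M ↦ TangentSpace 𝓘(ℝ, E) y)
    (F₃ := ℝ) (E₃ := fun _ : M ↦ ℝ) hy hy (by simp)).symm
  simp

lemma inner_comp_coordInv (Y Z : ∀ y : M, TangentSpace 𝓘(ℝ, E) y) :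
    (fun y ↦ g.inner y (Y y) (Z y)) ∘ coordInv x
      =ᶠ[𝓝 (coord x x)] fun e ↦ g.coordForm x e (coordField x Y e) (coordField x Z e) := by
  refine eventually_nhds_coord.2 ?_
  filter_upwards [chart_source_mem_nhds E x] with y hy
  refine (congrArg (fun z ↦ g.inner z (Y z) (Z z)) (coordInv_coord hy)).trans ?_
  simp [hy]

end SemiRiemannianMetric

end Charts

section Christoffel

variable {E : Type*} [NormedAddCommGroup E] [NormedSpace ℝ E]
  {M : Type*} [TopologicalSpace M] [ChartedSpace E M] [IsManifold 𝓘(ℝ, E) ∞ M]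

variable (E M) in
/-- The covariant derivative that at each point `x` is the derivative in the preferred chart at `x`.
It need not vary smoothly with `x`, which a `CovariantDerivative` does not require. -/
def chartCov : CovariantDerivative 𝓘(ℝ, E) E (TangentSpace 𝓘(ℝ, E) : M → Type _) where
  toFun Y x := ofModel x x ∘L fderiv ℝ (coordField x Y) (coord x x) ∘L toModel x x
  isCovariantDerivativeOnUniv :=
    { add := by
        intro Y Z x hY hZ _
        rw [mdifferentiableAt_iff_coordField] at hY hZ
        ext v
        simp [coordField_add, fderiv_add hY hZ]
      leibniz := by
        intro Y u x hY hu _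
        have hu' := mdifferentiableAt_iff_comp_coordInv.1 hu
        rw [mdifferentiableAt_iff_coordField] at hY
        ext v
        simp [coordField_smul, fderiv_smul hu' hY, mvfderiv_eq_fderiv_comp_coordInv hu v] }

lemma toModel_chartCov (x : M) (Y : ∀ y : M, TangentSpace 𝓘(ℝ, E) y) (v : TangentSpace 𝓘(ℝ, E) x) :
    toModel x x (chartCov E M Y x v) = fderiv ℝ (coordField x Y) (coord x x) (toModel x x v) :=
  toModel_ofModel (mem_chart_source E x) _

/-- `Γ` is the value at `x` of the Christoffel symbols of `cov` in the preferred chart at `x`. In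
`Γ u v` the field that is differentiated comes first, the direction second. -/
def IsChristoffelAt (cov : CovariantDerivative 𝓘(ℝ, E) E (TangentSpace 𝓘(ℝ, E) : M → Type _))
    (x : M) (Γ : E →L[ℝ] E →L[ℝ] E) : Prop :=
  ∀ Y : ∀ y : M, TangentSpace 𝓘(ℝ, E) y, MDiffAt (T% Y) x → ∀ v : TangentSpace 𝓘(ℝ, E) x,
    toModel x x (cov Y x v) = fderiv ℝ (coordField x Y) (coord x x) (toModel x x v)
      + Γ (toModel x x (Y x)) (toModel x x v)

/-- The covariant derivative whose Christoffel symbols at the centre `x` of each preferred chart are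
`Γ x`. -/
def covOfChristoffel (Γ : M → E →L[ℝ] E →L[ℝ] E) :
    CovariantDerivative 𝓘(ℝ, E) E (TangentSpace 𝓘(ℝ, E) : M → Type _) :=
  (chartCov E M).addOneForm fun x ↦
    ContinuousLinearMap.postcomp (TangentSpace 𝓘(ℝ, E) x) (ofModel x x) ∘L
      ContinuousLinearMap.precomp E (toModel x x) ∘L Γ x ∘L toModel x x

lemma isChristoffelAt_covOfChristoffel (Γ : M → E →L[ℝ] E →L[ℝ] E) (x : M) :
    IsChristoffelAt (covOfChristoffel Γ) x (Γ x) := by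
  intro Y _ v
  have hcov : covOfChristoffel Γ Y x v = chartCov E M Y x v
      + ofModel x x (Γ x (toModel x x (Y x)) (toModel x x v)) := rfl
  rw [hcov, map_add, toModel_chartCov, toModel_ofModel (mem_chart_source E x)]

lemma exists_isChristoffelAt [FiniteDimensional ℝ E]
    (cov : CovariantDerivative 𝓘(ℝ, E) E (TangentSpace 𝓘(ℝ, E) : M → Type _)) (x : M) :
    ∃ Γ : E →L[ℝ] E →L[ℝ] E, IsChristoffelAt cov x Γ := by
  refine ⟨ContinuousLinearMap.postcomp E (toModel x x) ∘L
      ContinuousLinearMap.precomp (TangentSpace 𝓘(ℝ, E) x) (ofModel x x) ∘L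
      cov.difference (chartCov E M) x ∘L ofModel x x, fun Y hY v ↦ ?_⟩
  have hdifference : cov.difference (chartCov E M) x (Y x) = cov Y x - chartCov E M Y x :=
    IsCovariantDerivativeOn.difference_apply (s := Set.univ) cov.isCovariantDerivativeOnUniv
      (chartCov E M).isCovariantDerivativeOnUniv (Set.mem_univ x) hY
  have hcov := congr(toModel x x ($hdifference v))
  rw [sub_apply, map_sub, toModel_chartCov, eq_sub_iff_add_eq'] at hcov
  rw [← hcov]
  simp

namespace IsChristoffelAt

variable {cov : CovariantDerivative 𝓘(ℝ, E) E (TangentSpace 𝓘(ℝ, E) : M → Type _)}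
  {x : M} {Γ : E →L[ℝ] E →L[ℝ] E}

lemma toModel_constField (h : IsChristoffelAt cov x Γ) (u : E) (v : TangentSpace 𝓘(ℝ, E) x) :
    toModel x x (cov (constField x u) x v) = Γ u (toModel x x v) := by
  rw [h _ (mdifferentiableAt_constField x u), (coordField_constField x u).fderiv_eq]
  simp [constField]

lemma toModel_torsion_apply [FiniteDimensional ℝ E] (h : IsChristoffelAt cov x Γ)
    (u v : TangentSpace 𝓘(ℝ, E) x) :
    haveI := FiniteDimensional.complete ℝ E
    toModel x x (cov.torsion x u v)
      = Γ (toModel x x v) (toModel x x u) - Γ (toModel x x u) (toModel x x v) := by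
  have := FiniteDimensional.complete ℝ E
  have hconst := mdifferentiableAt_constField (E := E) x
  have htorsion := congr(toModel x x
    $(cov.torsion_apply (hconst (toModel x x u)) (hconst (toModel x x v))))
  rw [map_sub, map_sub, toModel_mlieBracket, h _ (hconst _), h _ (hconst _),
    add_sub_add_comm, add_sub_cancel_left] at htorsion
  simpa [constField] using htorsion

lemma torsion_eq_zero_iff [FiniteDimensional ℝ E] (h : IsChristoffelAt cov x Γ) :
    haveI := FiniteDimensional.complete ℝ E
    cov.torsion x = 0 ↔ ∀ u v, Γ u v = Γ v u := by
  have := FiniteDimensional.complete ℝ E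
  refine ⟨fun h0 u v ↦ ?_, fun hsymm ↦ ?_⟩
  · simpa [h0, sub_eq_zero, eq_comm (a := (0 : E))]
      using h.toModel_torsion_apply (ofModel x x v) (ofModel x x u)
  · ext u v
    refine toModel_injective x ?_
    rw [h.toModel_torsion_apply, hsymm, sub_self]
    simp

end IsChristoffelAt

namespace SemiRiemannianMetric

variable (g : SemiRiemannianMetric E M) {x : M}

lemma inner_eq_coordForm (u w : TangentSpace 𝓘(ℝ, E) x) :
    g.inner x u w = g.coordForm x (coord x x) (toModel x x u) (toModel x x w) := by
  simp

lemma mvfderiv_inner {Y Z : ∀ y : M, TangentSpace 𝓘(ℝ, E) y}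
    (hY : MDiffAt (T% Y) x) (hZ : MDiffAt (T% Z) x) (v : TangentSpace 𝓘(ℝ, E) x) :
    (d% (fun y ↦ g.inner y (Y y) (Z y)) x) v
      = fderiv ℝ (g.coordForm x) (coord x x) (toModel x x v) (toModel x x (Y x)) (toModel x x (Z x))
        + g.coordForm x (coord x x) (fderiv ℝ (coordField x Y) (coord x x) (toModel x x v))
          (toModel x x (Z x))
        + g.coordForm x (coord x x) (toModel x x (Y x))
          (fderiv ℝ (coordField x Z) (coord x x) (toModel x x v)) := by
  have hg := g.differentiableAt_coordForm (x := x)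
  rw [mdifferentiableAt_iff_coordField] at hY hZ
  have hinner : MDifferentiableAt 𝓘(ℝ, E) 𝓘(ℝ, ℝ) (fun y ↦ g.inner y (Y y) (Z y)) x :=
    mdifferentiableAt_iff_comp_coordInv.2 <|
      ((hg.clm_apply hY).clm_apply hZ).congr_of_eventuallyEq (g.inner_comp_coordInv Y Z)
  rw [mvfderiv_eq_fderiv_comp_coordInv hinner, (g.inner_comp_coordInv Y Z).fderiv_eq,
    fderiv_clm_apply₂ hg hY hZ]
  simp

end SemiRiemannianMetric

namespace IsChristoffelAt

variable {cov : CovariantDerivative 𝓘(ℝ, E) E (TangentSpace 𝓘(ℝ, E) : M → Type _)}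
  {x : M} {Γ : E →L[ℝ] E →L[ℝ] E}

lemma compatible_iff (h : IsChristoffelAt cov x Γ) (g : SemiRiemannianMetric E M) :
    (∀ (v : TangentSpace 𝓘(ℝ, E) x) (Y Z : ∀ y : M, TangentSpace 𝓘(ℝ, E) y),
      MDiffAt (T% Y) x → MDiffAt (T% Z) x → (d% (fun y ↦ g.inner y (Y y) (Z y)) x) v
        = g.inner x (cov Y x v) (Z x) + g.inner x (Y x) (cov Z x v)) ↔
    ∀ v u w, fderiv ℝ (g.coordForm x) (coord x x) v u w
      = g.coordForm x (coord x x) (Γ u v) w + g.coordForm x (coord x x) u (Γ w v) := by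
  refine ⟨fun hcompatible v u w ↦ ?_, fun hmetric v Y Z hY hZ ↦ ?_⟩
  · have hconst := mdifferentiableAt_constField (E := E) x
    have huw := hcompatible (ofModel x x v) _ _ (hconst u) (hconst w)
    rw [g.mvfderiv_inner (hconst u) (hconst w), g.inner_eq_coordForm, g.inner_eq_coordForm,
      h.toModel_constField, h.toModel_constField, (coordField_constField x u).fderiv_eq,
      (coordField_constField x w).fderiv_eq] at huw
    simpa [constField] using huw
  · rw [g.mvfderiv_inner hY hZ, hmetric, g.inner_eq_coordForm, g.inner_eq_coordForm, h Y hY, h Z hZ]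
    simp only [map_add, add_apply]
    ring

lemma toModel_cov_apply_sub (h : IsChristoffelAt cov x Γ)
    {A : ∀ y : M, TangentSpace 𝓘(ℝ, E) y →L[ℝ] TangentSpace 𝓘(ℝ, E) y}
    (hA : DifferentiableAt ℝ (coordEnd x A) (coord x x))
    {Y : ∀ y : M, TangentSpace 𝓘(ℝ, E) y} (hY : MDiffAt (T% Y) x) (v : TangentSpace 𝓘(ℝ, E) x) :
    toModel x x (cov (fun y ↦ A y (Y y)) x v - A x (cov Y x v))
      = covDerivEnd Γ (coordEnd x A) (coord x x) (toModel x x v) (toModel x x (Y x)) := by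
  have hY' := mdifferentiableAt_iff_coordField.1 hY
  have hAY := coordField_apply_coordEnd (A := A) x Y
  have hAY' : MDiffAt (T% (fun y ↦ A y (Y y))) x :=
    mdifferentiableAt_iff_coordField.2 ((hA.clm_apply hY').congr_of_eventuallyEq hAY)
  have hA_cov : toModel x x (A x (cov Y x v))
      = coordEnd x A (coord x x) (toModel x x (cov Y x v)) := by
    simp
  rw [map_sub, hA_cov, h _ hAY', h Y hY, hAY.fderiv_eq, fderiv_clm_apply hA hY']
  simp [covDerivEnd_apply]
  abel

end IsChristoffelAt

lemma isLeviCivita_iff [FiniteDimensional ℝ E] {g : SemiRiemannianMetric E M}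
    {cov : CovariantDerivative 𝓘(ℝ, E) E (TangentSpace 𝓘(ℝ, E) : M → Type _)}
    {Γ : M → E →L[ℝ] E →L[ℝ] E} (hΓ : ∀ x, IsChristoffelAt cov x (Γ x)) :
    IsLeviCivita g cov ↔ ∀ x, IsLeviCivitaSymbol (g.coordForm x) (coord x x) (Γ x) where
  mp h x :=
    { symm := (hΓ x).torsion_eq_zero_iff.1 (congrFun h.torsion_eq_zero x)
      metric := ((hΓ x).compatible_iff g).1 (h.compatible x) }
  mpr h :=
    { torsion_eq_zero := funext fun x ↦ (hΓ x).torsion_eq_zero_iff.2 (h x).symm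
      compatible := fun x ↦ ((hΓ x).compatible_iff g).2 (h x).metric }

/-- The fibre `σ_x`, expressed in the preferred chart at `x`. -/
def AlmostParaquaternionicStructure.coordFiber (σ : AlmostParaquaternionicStructure E M) (x : M) :
    Submodule ℝ (E →L[ℝ] E) :=
  (σ.fiber x).map (ContinuousLinearMap.postcomp E (toModel x x) ∘L
    ContinuousLinearMap.precomp (TangentSpace 𝓘(ℝ, E) x) (ofModel x x)).toLinearMap

lemma IsCanonicalLocalBasis.span_range_coordEnd {σ : AlmostParaquaternionicStructure E M}
    {U : Set M} {J : Fin 3 → ∀ y : M, TangentSpace 𝓘(ℝ, E) y →L[ℝ] TangentSpace 𝓘(ℝ, E) y}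
    (hJ : IsCanonicalLocalBasis σ.fiber U J) {x : M} (hx : x ∈ U) :
    Submodule.span ℝ (Set.range fun β ↦ coordEnd x (J β) (coord x x)) = σ.coordFiber x := by
  rw [AlmostParaquaternionicStructure.coordFiber, ← hJ.span_eq x hx, Submodule.map_span,
    ← Set.range_comp]
  congr 2
  ext β
  simp

/-- The covariant derivatives at `x`, with Christoffel symbols `Γ`, of the local sections of `σ`
belong to `σ_x`. -/
def IsParallelAt (σ : AlmostParaquaternionicStructure E M) (x : M) (Γ : E →L[ℝ] E →L[ℝ] E) : Prop :=
  ∀ (U : Set M) (A : ∀ y : M, TangentSpace 𝓘(ℝ, E) y →L[ℝ] TangentSpace 𝓘(ℝ, E) y),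
    IsOpen U → SmoothEndOn A U → (∀ y ∈ U, A y ∈ σ.fiber y) → x ∈ U →
    ∀ v, covDerivEnd Γ (coordEnd x A) (coord x x) v ∈ σ.coordFiber x

lemma isParallel_iff {σ : AlmostParaquaternionicStructure E M}
    {cov : CovariantDerivative 𝓘(ℝ, E) E (TangentSpace 𝓘(ℝ, E) : M → Type _)}
    {Γ : M → E →L[ℝ] E →L[ℝ] E} (hΓ : ∀ x, IsChristoffelAt cov x (Γ x)) :
    IsParallel cov σ ↔ ∀ x, IsParallelAt σ x (Γ x) := by
  refine ⟨fun h x U A hU hA hAσ hx v ↦ ?_, fun h U A hU hA hAσ x hx v ↦ ?_⟩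
  · obtain ⟨B, hB, hcov⟩ := h U A hU hA hAσ x hx (ofModel x x v)
    refine ⟨B, hB, ContinuousLinearMap.ext fun u ↦ ?_⟩
    have hu := (hΓ x).toModel_cov_apply_sub (differentiableAt_coordEnd hA hU hx)
      (mdifferentiableAt_constField x u) (ofModel x x v)
    rw [hcov _ (mdifferentiableAt_constField x u)] at hu
    simpa [constField] using hu
  · obtain ⟨B, hB, hBcov⟩ := h x U A hU hA hAσ hx (toModel x x v)
    refine ⟨B, hB, fun Y hY ↦ toModel_injective x ?_⟩
    rw [(hΓ x).toModel_cov_apply_sub (differentiableAt_coordEnd hA hU hx) hY, ← hBcov]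
    simp

theorem isParaquaternionicKahler_iff [FiniteDimensional ℝ E]
    {σ : AlmostParaquaternionicStructure E M} {g : SemiRiemannianMetric E M} :
    IsParaquaternionicKahler σ g ↔ IsAlmostParaquaternionicHermitian σ g ∧
      ∀ x, ∃ Γ, IsLeviCivitaSymbol (g.coordForm x) (coord x x) Γ ∧ IsParallelAt σ x Γ := by
  refine ⟨fun ⟨hhermitian, cov, hcov, hparallel⟩ ↦ ⟨hhermitian, fun x ↦ ?_⟩,
    fun ⟨hhermitian, h⟩ ↦ ⟨hhermitian, ?_⟩⟩
  · choose Γ hΓ using exists_isChristoffelAt cov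
    exact ⟨Γ x, (isLeviCivita_iff hΓ).1 hcov x, (isParallel_iff hΓ).1 hparallel x⟩
  · choose Γ hΓ hparallel using h
    have hcov := isChristoffelAt_covOfChristoffel Γ
    exact ⟨covOfChristoffel Γ, (isLeviCivita_iff hcov).2 hΓ, (isParallel_iff hcov).2 hparallel⟩

end Christoffel

section CoordMap

lemma eventually_mem_chart_source (E F : Type*) {M N : Type*} [TopologicalSpace E]
    [TopologicalSpace F] [TopologicalSpace M] [ChartedSpace E M] [TopologicalSpace N]
    [ChartedSpace F N] {φ : N → M} {p : N} (hφ : ContinuousAt φ p) :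
    ∀ᶠ q in 𝓝 p, q ∈ (chartAt F p).source ∧ φ q ∈ (chartAt E (φ p)).source :=
  Filter.Eventually.and (chart_source_mem_nhds F p)
    (hφ.eventually_mem (chart_source_mem_nhds E (φ p)))

variable {E : Type*} [NormedAddCommGroup E] [NormedSpace ℝ E]
  {M : Type*} [TopologicalSpace M] [ChartedSpace E M]
  {F : Type*} [NormedAddCommGroup F] [NormedSpace ℝ F]
  {N : Type*} [TopologicalSpace N] [ChartedSpace F N] {φ : N → M} {p : N}

/-- The coordinate expression of a map in the preferred charts at `p` and `φ p`. -/
def coordMap (φ : N → M) (p : N) : F → E := coord (φ p) ∘ φ ∘ coordInv p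

@[simp] lemma coordMap_coord {q : N} (hq : q ∈ (chartAt F p).source) :
    coordMap (E := E) (F := F) φ p (coord p q) = coord (φ p) (φ q) :=
  congrArg (coord (φ p) ∘ φ) (coordInv_coord hq)

lemma contDiffAt_coordMap {n : ℕ∞ω} (hφ : ContMDiffAt 𝓘(ℝ, F) 𝓘(ℝ, E) n φ p) :
    ContDiffAt ℝ n (coordMap φ p : F → E) (coord p p) := by
  have hwritten := (contMDiffAt_iff.1 hφ).2
  rwa [ModelWithCorners.range_eq_univ, contDiffWithinAt_univ] at hwritten

lemma fderiv_coordMap [IsManifold 𝓘(ℝ, E) ∞ M] [IsManifold 𝓘(ℝ, F) ∞ N] {q : N}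
    (hφ : MDifferentiableAt 𝓘(ℝ, F) 𝓘(ℝ, E) φ q)
    (hd : DifferentiableAt ℝ (coordMap φ p : F → E) (coord p q))
    (hq : q ∈ (chartAt F p).source) (hφq : φ q ∈ (chartAt E (φ p)).source) :
    fderiv ℝ (coordMap φ p : F → E) (coord p q)
      = toModel (φ p) (φ q) ∘L mfderiv 𝓘(ℝ, F) 𝓘(ℝ, E) φ q ∘L ofModel p q := by
  have hcomp : (coordMap φ p : F → E) ∘ coord p =ᶠ[𝓝 q] coord (φ p) ∘ φ := by
    filter_upwards [(chartAt F p).open_source.mem_nhds hq] with y hy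
    simp [hy]
  have hleft := mfderiv_comp (I := 𝓘(ℝ, F)) (I' := 𝓘(ℝ, F)) (I'' := 𝓘(ℝ, E)) q
    hd.mdifferentiableAt (mdifferentiableAt_coord hq)
  have hright := mfderiv_comp (I := 𝓘(ℝ, F)) (I' := 𝓘(ℝ, E)) (I'' := 𝓘(ℝ, E)) q
    (mdifferentiableAt_coord hφq) hφ
  rw [hcomp.mfderiv_eq, hright, mfderiv_eq_fderiv, ← toModel_eq_mfderiv hq,
    ← toModel_eq_mfderiv hφq] at hleft
  ext u
  refine Eq.trans (congrArg _ (toModel_ofModel hq u).symm) ?_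
  exact congr($hleft (ofModel p q u)).symm

lemma eventually_fderiv_coordMap [IsManifold 𝓘(ℝ, E) ∞ M] [IsManifold 𝓘(ℝ, F) ∞ N]
    (hφ : ContMDiff 𝓘(ℝ, F) 𝓘(ℝ, E) ∞ φ) (p : N) :
    ∀ᶠ q in 𝓝 p, fderiv ℝ (coordMap φ p : F → E) (coord p q)
      = toModel (φ p) (φ q) ∘L mfderiv 𝓘(ℝ, F) 𝓘(ℝ, E) φ q ∘L ofModel p q := by
  have hsmooth : ContDiffAt ℝ 1 (coordMap φ p : F → E) (coord p p) :=
    contDiffAt_coordMap ((hφ p).of_le (by exact_mod_cast le_top))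
  filter_upwards [eventually_mem_chart_source E F (hφ p).continuousAt,
    eventually_nhds_coord.1 (hsmooth.eventually (by simp))] with q ⟨hq, hφq⟩ hd
  exact fderiv_coordMap ((hφ q).mdifferentiableAt (by simp)) (hd.differentiableAt one_ne_zero)
    hq hφq

end CoordMap

section CRSubmersion

variable {E : Type*} [NormedAddCommGroup E] [NormedSpace ℝ E]
  {M : Type*} [TopologicalSpace M] [ChartedSpace E M] [IsManifold 𝓘(ℝ, E) ∞ M]
  {F : Type*} [NormedAddCommGroup F] [NormedSpace ℝ F]
  {N : Type*} [TopologicalSpace N] [ChartedSpace F N]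

lemma inducedForm_apply (g : SemiRiemannianMetric E M) (ι : N → M) (p : N)
    (v w : TangentSpace 𝓘(ℝ, F) p) : inducedForm g ι p v w
      = g.inner (ι p) (mfderiv 𝓘(ℝ, F) 𝓘(ℝ, E) ι p v) (mfderiv 𝓘(ℝ, F) 𝓘(ℝ, E) ι p w) := rfl

lemma inducedForm_comm (g : SemiRiemannianMetric E M) (ι : N → M) (p : N)
    (v w : TangentSpace 𝓘(ℝ, F) p) : inducedForm g ι p v w = inducedForm g ι p w v :=
  g.symm _ _ _

lemma inducedForm_isRefl (g : SemiRiemannianMetric E M) (ι : N → M) (p : N) :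
    (inducedForm (F := F) g ι p).IsRefl :=
  fun v w h ↦ (inducedForm_comm g ι p w v).trans h

lemma IsCanonicalLocalBasis.inner_apply_left {σ : AlmostParaquaternionicStructure E M}
    {g : SemiRiemannianMetric E M} (hσ : IsAlmostParaquaternionicHermitian σ g) {U : Set M}
    {J : Fin 3 → ∀ x : M, TangentSpace 𝓘(ℝ, E) x →L[ℝ] TangentSpace 𝓘(ℝ, E) x}
    (hJ : IsCanonicalLocalBasis σ.fiber U J) {x : M} (hx : x ∈ U) (α : Fin 3)
    (v w : TangentSpace 𝓘(ℝ, E) x) :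
    g.inner x (J α x v) w = -g.inner x v (J α x w) := by
  have hisometry := hσ U J hJ x hx α v (J α x w)
  have hsq : J α x (J α x w) = (-eps α) • w := congr($(hJ.sq x hx α) w)
  have heps : eps α * eps α = 1 := by fin_cases α <;> simp [eps]
  rw [hsq, map_smul, smul_eq_mul] at hisometry
  linear_combination (-eps α) * hisometry - (g.inner x (J α x v) w + g.inner x v (J α x w)) * heps

lemma IsCanonicalLocalBasis.coordForm_apply_left {σ : AlmostParaquaternionicStructure E M}
    {g : SemiRiemannianMetric E M} (hσ : IsAlmostParaquaternionicHermitian σ g) {U : Set M}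
    {J : Fin 3 → ∀ x : M, TangentSpace 𝓘(ℝ, E) x →L[ℝ] TangentSpace 𝓘(ℝ, E) x}
    (hJ : IsCanonicalLocalBasis σ.fiber U J) {x : M} (hx : x ∈ U) (α : Fin 3) (u w : E) :
    g.coordForm x (coord x x) (coordEnd x (J α) (coord x x) u) w
      = -g.coordForm x (coord x x) u (coordEnd x (J α) (coord x x) w) := by
  simp [hJ.inner_apply_left hσ hx]

lemma IsCanonicalLocalBasis.linearIndependent_coordEnd {σ : AlmostParaquaternionicStructure E M}
    {U : Set M} {J : Fin 3 → ∀ x : M, TangentSpace 𝓘(ℝ, E) x →L[ℝ] TangentSpace 𝓘(ℝ, E) x}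
    (hJ : IsCanonicalLocalBasis σ.fiber U J) {x : M} (hx : x ∈ U) :
    LinearIndependent ℝ fun α ↦ coordEnd x (J α) (coord x x) := by
  refine Fintype.linearIndependent_iff.2 fun c hc ↦
    Fintype.linearIndependent_iff.1 (hJ.linearIndependent x hx) c ?_
  ext w
  refine toModel_injective x ?_
  simpa [sum_apply] using congr($hc (toModel x x w))

variable {E' : Type*} [NormedAddCommGroup E'] [NormedSpace ℝ E']
  {M' : Type*} [TopologicalSpace M'] [ChartedSpace E' M'] [IsManifold 𝓘(ℝ, E') ∞ M']
  {σ : AlmostParaquaternionicStructure E M}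

/-- `l` is the horizontal lift `T_{f q} M' → D q` at the point `q` of a submersion `f` with
horizontal distribution `D`. -/
structure IsHorizontalLift (g : SemiRiemannianMetric E M) (ι : N → M)
    (D : ∀ p : N, Submodule ℝ (TangentSpace 𝓘(ℝ, F) p)) (g' : SemiRiemannianMetric E' M')
    (f : N → M') (q : N) (l : TangentSpace 𝓘(ℝ, E') (f q) →L[ℝ] TangentSpace 𝓘(ℝ, F) q) :
    Prop where
  mem (w : TangentSpace 𝓘(ℝ, E') (f q)) : l w ∈ D q
  mfderiv_apply (w : TangentSpace 𝓘(ℝ, E') (f q)) : mfderiv 𝓘(ℝ, F) 𝓘(ℝ, E') f q (l w) = w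
  apply_mfderiv (v : TangentSpace 𝓘(ℝ, F) q) (hv : v ∈ D q) :
    l (mfderiv 𝓘(ℝ, F) 𝓘(ℝ, E') f q v) = v
  adjoint (w : TangentSpace 𝓘(ℝ, E') (f q)) (u : TangentSpace 𝓘(ℝ, F) q) :
    inducedForm g ι q (l w) u = g'.inner (f q) w (mfderiv 𝓘(ℝ, F) 𝓘(ℝ, E') f q u)

variable {g : SemiRiemannianMetric E M} {ι : N → M}
  {D : ∀ p : N, Submodule ℝ (TangentSpace 𝓘(ℝ, F) p)}
  {σ' : AlmostParaquaternionicStructure E' M'} {g' : SemiRiemannianMetric E' M'} {f : N → M'}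

namespace IsParaquaternionicCRSubmersion

lemma mem_orthogonal_iff (hf : IsParaquaternionicCRSubmersion σ g ι D σ' g' f) {q : N}
    {v : TangentSpace 𝓘(ℝ, F) q} :
    v ∈ (inducedForm g ι q).orthogonal (D q) ↔ mfderiv 𝓘(ℝ, F) 𝓘(ℝ, E') f q v = 0 := by
  rw [← hf.vertical_eq q]
  exact LinearMap.mem_ker

lemma eq_zero_of_mem_orthogonal (hf : IsParaquaternionicCRSubmersion σ g ι D σ' g' f) {q : N}
    {v : TangentSpace 𝓘(ℝ, F) q} (hv : v ∈ (inducedForm g ι q).orthogonal (D q))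
    (hortho : ∀ w ∈ (inducedForm g ι q).orthogonal (D q), inducedForm g ι q v w = 0) : v = 0 := by
  rw [← hf.vertical_eq q] at hv hortho
  exact congrArg Subtype.val
    ((hf.submersion.nondegenerate_fibers q).1 ⟨v, hv⟩ fun w ↦ hortho w w.2)

lemma eq_zero_of_inducedForm_eq_zero (hf : IsParaquaternionicCRSubmersion σ g ι D σ' g' f) {q : N}
    {v : TangentSpace 𝓘(ℝ, F) q} (hv : ∀ w, inducedForm g ι q v w = 0) : v = 0 :=
  hf.eq_zero_of_mem_orthogonal (fun w _ ↦ (inducedForm_comm g ι q w v).trans (hv w))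
    fun w _ ↦ hv w

lemma eq_zero_of_mfderiv_eq_zero (hf : IsParaquaternionicCRSubmersion σ g ι D σ' g' f) {q : N}
    {v : TangentSpace 𝓘(ℝ, F) q} (hv : mfderiv 𝓘(ℝ, F) 𝓘(ℝ, E) ι q v = 0) : v = 0 :=
  hf.eq_zero_of_inducedForm_eq_zero fun w ↦ by simp [inducedForm_apply, hv]

lemma disjoint_orthogonal (hf : IsParaquaternionicCRSubmersion σ g ι D σ' g' f) (q : N) :
    Disjoint (D q) ((inducedForm g ι q).orthogonal (D q)) :=
  Submodule.disjoint_def.2 fun v hvD hv ↦ hf.eq_zero_of_mem_orthogonal hv fun _ hw ↦ hw v hvD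

lemma finiteDimensional [FiniteDimensional ℝ E]
    (hf : IsParaquaternionicCRSubmersion σ g ι D σ' g' f) (q : N) : FiniteDimensional ℝ F := by
  let dι : F →ₗ[ℝ] E := (mfderiv 𝓘(ℝ, F) 𝓘(ℝ, E) ι q).toLinearMap
  exact FiniteDimensional.of_injective dι
    ((injective_iff_map_eq_zero dι).2 fun _ hv ↦ hf.eq_zero_of_mfderiv_eq_zero hv)

lemma exists_add_eq [FiniteDimensional ℝ F]
    (hf : IsParaquaternionicCRSubmersion σ g ι D σ' g' f) (q : N) (u : TangentSpace 𝓘(ℝ, F) q) :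
    ∃ a ∈ D q, ∃ b ∈ (inducedForm g ι q).orthogonal (D q), a + b = u := by
  have : FiniteDimensional ℝ (TangentSpace 𝓘(ℝ, F) q) := inferInstanceAs (FiniteDimensional ℝ F)
  have hcompl := (LinearMap.BilinForm.isCompl_orthogonal_iff_disjoint
    (inducedForm_isRefl g ι q)).2 (hf.disjoint_orthogonal q)
  exact Submodule.mem_sup.1 (hcompl.sup_eq_top ▸ Submodule.mem_top)

lemma bijective_domRestrict_mfderiv [FiniteDimensional ℝ F]
    (hf : IsParaquaternionicCRSubmersion σ g ι D σ' g' f) (q : N) :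
    Function.Bijective ((mfderiv 𝓘(ℝ, F) 𝓘(ℝ, E') f q).toLinearMap.domRestrict (D q)) := by
  constructor
  · refine (injective_iff_map_eq_zero _).2 fun v hv ↦ Subtype.ext ?_
    exact Submodule.disjoint_def.1 (hf.disjoint_orthogonal q) v v.2 (hf.mem_orthogonal_iff.2 hv)
  · intro w
    obtain ⟨u, hu⟩ := hf.submersion.surjective_mfderiv q w
    obtain ⟨a, ha, b, hb, rfl⟩ := hf.exists_add_eq q u
    rw [map_add, hf.mem_orthogonal_iff.1 hb, add_zero] at hu
    exact ⟨⟨a, ha⟩, hu⟩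

theorem exists_isHorizontalLift [FiniteDimensional ℝ F] [FiniteDimensional ℝ E']
    (hf : IsParaquaternionicCRSubmersion σ g ι D σ' g' f) (q : N) :
    ∃ l, IsHorizontalLift g ι D g' f q l := by
  have : FiniteDimensional ℝ (TangentSpace 𝓘(ℝ, E') (f q)) :=
    inferInstanceAs (FiniteDimensional ℝ E')
  have : T2Space (TangentSpace 𝓘(ℝ, E') (f q)) := inferInstanceAs (T2Space E')
  let dfD := LinearEquiv.ofBijective _ (hf.bijective_domRestrict_mfderiv q)
  have hdf (w : TangentSpace 𝓘(ℝ, E') (f q)) :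
      mfderiv 𝓘(ℝ, F) 𝓘(ℝ, E') f q (dfD.symm w) = w := dfD.apply_symm_apply w
  refine ⟨LinearMap.toContinuousLinearMap ((D q).subtype ∘ₗ dfD.symm.toLinearMap),
    fun w ↦ (dfD.symm w).2, hdf,
    fun v hv ↦ congrArg Subtype.val (dfD.symm_apply_apply ⟨v, hv⟩), fun w u ↦ ?_⟩
  obtain ⟨a, ha, b, hb, rfl⟩ := hf.exists_add_eq q u
  change inducedForm g ι q (dfD.symm w : TangentSpace 𝓘(ℝ, F) q) (a + b) = _
  rw [map_add, map_add, hf.mem_orthogonal_iff.1 hb, hb _ (dfD.symm w).2,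
    ← hf.isometry q _ _ (dfD.symm w).2 ha, hdf, add_zero, add_zero]

end IsParaquaternionicCRSubmersion

namespace IsHorizontalLift

variable {q : N} {l : TangentSpace 𝓘(ℝ, E') (f q) →L[ℝ] TangentSpace 𝓘(ℝ, F) q}

lemma inner_mfderiv (h : IsHorizontalLift g ι D g' f q l) (v w : TangentSpace 𝓘(ℝ, E') (f q)) :
    g.inner (ι q) (mfderiv 𝓘(ℝ, F) 𝓘(ℝ, E) ι q (l v)) (mfderiv 𝓘(ℝ, F) 𝓘(ℝ, E) ι q (l w))
      = g'.inner (f q) v w := by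
  rw [← inducedForm_apply, h.adjoint, h.mfderiv_apply]

lemma exists_isCanonicalLocalBasis (h : IsHorizontalLift g ι D g' f q l)
    (hf : IsParaquaternionicCRSubmersion σ g ι D σ' g' f)
    {U' : Set M'} {J' : Fin 3 → ∀ x : M', TangentSpace 𝓘(ℝ, E') x →L[ℝ] TangentSpace 𝓘(ℝ, E') x}
    (hJ' : IsCanonicalLocalBasis σ'.fiber U' J') (hq : f q ∈ U') :
    ∃ (U : Set M) (J : Fin 3 → ∀ x : M, TangentSpace 𝓘(ℝ, E) x →L[ℝ] TangentSpace 𝓘(ℝ, E) x),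
      IsCanonicalLocalBasis σ.fiber U J ∧ ι q ∈ U ∧
      ∀ α w, mfderiv 𝓘(ℝ, F) 𝓘(ℝ, E) ι q (l (J' α (f q) w))
        = J α (ι q) (mfderiv 𝓘(ℝ, F) 𝓘(ℝ, E) ι q (l w)) := by
  obtain ⟨U, J, hJ, hU, hcompatible⟩ := hf.compatible q U' J' hJ' hq
  refine ⟨U, J, hJ, hU, fun α w ↦ ?_⟩
  obtain ⟨z, hz, hιz, hfz⟩ := hcompatible α (l w) (h.mem w)
  rw [h.mfderiv_apply] at hfz
  rw [← hιz, ← hfz, h.apply_mfderiv z hz]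

lemma exists_mem_fiber_comp (h : IsHorizontalLift g ι D g' f q l)
    (hf : IsParaquaternionicCRSubmersion σ g ι D σ' g' f)
    {A : TangentSpace 𝓘(ℝ, E') (f q) →L[ℝ] TangentSpace 𝓘(ℝ, E') (f q)}
    (hA : A ∈ σ'.fiber (f q)) :
    ∃ B ∈ σ.fiber (ι q), ∀ w, mfderiv 𝓘(ℝ, F) 𝓘(ℝ, E) ι q (l (A w))
      = B (mfderiv 𝓘(ℝ, F) 𝓘(ℝ, E) ι q (l w)) := by
  obtain ⟨U', J', hq, hJ'⟩ := σ'.exists_basis (f q)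
  obtain ⟨U, J, hJ, hU, hJJ'⟩ := h.exists_isCanonicalLocalBasis hf hJ' hq
  rw [← hJ'.span_eq _ hq, Submodule.mem_span_range_iff_exists_fun] at hA
  obtain ⟨c, rfl⟩ := hA
  refine ⟨∑ β, c β • J β (ι q), ?_, fun w ↦ by simp [sum_apply, hJJ']⟩
  rw [← hJ.span_eq _ hU, Submodule.mem_span_range_iff_exists_fun]
  exact ⟨c, rfl⟩

end IsHorizontalLift

lemma IsParaquaternionicCRSubmersion.isAlmostParaquaternionicHermitian [FiniteDimensional ℝ E]
    [FiniteDimensional ℝ E'] (hf : IsParaquaternionicCRSubmersion σ g ι D σ' g' f)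
    (hσ : IsAlmostParaquaternionicHermitian σ g) : IsAlmostParaquaternionicHermitian σ' g' := by
  intro U' J' hJ' x hx α v w
  obtain ⟨q, rfl⟩ := hf.submersion.surjective x
  have := hf.finiteDimensional q
  obtain ⟨l, hl⟩ := hf.exists_isHorizontalLift q
  obtain ⟨U, J, hJ, hU, hJJ'⟩ := hl.exists_isCanonicalLocalBasis hf hJ' hx
  rw [← hl.inner_mfderiv, ← hl.inner_mfderiv, hJJ', hJJ', hσ U J hJ (ι q) hU]

end CRSubmersion

section CoordLift

variable {E : Type*} [NormedAddCommGroup E] [NormedSpace ℝ E]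
  {M : Type*} [TopologicalSpace M] [ChartedSpace E M] [IsManifold 𝓘(ℝ, E) ∞ M]
  {F : Type*} [NormedAddCommGroup F] [NormedSpace ℝ F]
  {N : Type*} [TopologicalSpace N] [ChartedSpace F N] [IsManifold 𝓘(ℝ, F) ∞ N]
  {E' : Type*} [NormedAddCommGroup E'] [NormedSpace ℝ E']
  {M' : Type*} [TopologicalSpace M'] [ChartedSpace E' M'] [IsManifold 𝓘(ℝ, E') ∞ M']
  {σ : AlmostParaquaternionicStructure E M} {g : SemiRiemannianMetric E M} {ι : N → M}
  {D : ∀ p : N, Submodule ℝ (TangentSpace 𝓘(ℝ, F) p)}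
  {σ' : AlmostParaquaternionicStructure E' M'} {g' : SemiRiemannianMetric E' M'} {f : N → M'}
  {l : ∀ q : N, TangentSpace 𝓘(ℝ, E') (f q) →L[ℝ] TangentSpace 𝓘(ℝ, F) q}

/-- The coordinate expression of a field of linear maps `T_{f q} M' → T_q N` in the preferred
charts at `f p` and `p`. -/
def coordLift (f : N → M')
    (l : ∀ q : N, TangentSpace 𝓘(ℝ, E') (f q) →L[ℝ] TangentSpace 𝓘(ℝ, F) q) (p : N) (e : F) :
    E' →L[ℝ] F :=
  toModel p (coordInv p e) ∘L l (coordInv p e) ∘L ofModel (f p) (f (coordInv p e))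

@[simp] lemma coordLift_coord {p q : N} (hq : q ∈ (chartAt F p).source) :
    coordLift f l p (coord p q) = toModel p q ∘L l q ∘L ofModel (f p) (f q) :=
  congrArg (fun y ↦ toModel p y ∘L l y ∘L ofModel (f p) (f y)) (coordInv_coord hq)

lemma eventually_coordForm_fderiv_coordMap (g : SemiRiemannianMetric E M)
    (hι : ContMDiff 𝓘(ℝ, F) 𝓘(ℝ, E) ∞ ι) (p : N) :
    ∀ᶠ q in 𝓝 p, ∀ u v : F, g.coordForm (ι p) (coordMap ι p (coord (E := F) p q))
        (fderiv ℝ (coordMap ι p) (coord p q) u) (fderiv ℝ (coordMap ι p) (coord p q) v)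
      = inducedForm g ι q (ofModel p q u) (ofModel p q v) := by
  filter_upwards [eventually_fderiv_coordMap hι p,
    eventually_mem_chart_source E F (hι p).continuousAt] with q hdι ⟨hq, hιq⟩ u v
  simp [hdι, hq, hιq, inducedForm_apply]

lemma eventually_ambientLift_coordLift (hι : ContMDiff 𝓘(ℝ, F) 𝓘(ℝ, E) ∞ ι) (p : N) :
    ∀ᶠ q in 𝓝 p, ambientLift (coordMap ι p) (coordLift f l p) (coord p q)
      = toModel (ι p) (ι q) ∘L mfderiv 𝓘(ℝ, F) 𝓘(ℝ, E) ι q ∘L l q ∘L ofModel (f p) (f q) := by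
  filter_upwards [eventually_fderiv_coordMap hι p, chart_source_mem_nhds F p] with q hdι hq
  ext w
  simp [ambientLift, hdι, hq]

lemma eventually_coordLift_isSection (hf : ContMDiff 𝓘(ℝ, F) 𝓘(ℝ, E') ∞ f)
    (hl : ∀ q, IsHorizontalLift g ι D g' f q (l q)) (p : N) :
    ∀ᶠ e in 𝓝 (coord p p), ∀ w, fderiv ℝ (coordMap f p : F → E') e (coordLift f l p e w) = w := by
  rw [eventually_nhds_coord]
  filter_upwards [eventually_fderiv_coordMap hf p,
    eventually_mem_chart_source E' F (hf p).continuousAt] with q hdf ⟨hq, hfq⟩ w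
  simp [hdf, hq, hfq, (hl q).mfderiv_apply]

lemma eventually_coordLift_adjoint (hι : ContMDiff 𝓘(ℝ, F) 𝓘(ℝ, E) ∞ ι)
    (hf : ContMDiff 𝓘(ℝ, F) 𝓘(ℝ, E') ∞ f) (hl : ∀ q, IsHorizontalLift g ι D g' f q (l q)) (p : N) :
    ∀ᶠ e in 𝓝 (coord p p), ∀ w u, g.coordForm (ι p) (coordMap ι p e)
        (fderiv ℝ (coordMap ι p) e (coordLift f l p e w)) (fderiv ℝ (coordMap ι p) e u)
      = g'.coordForm (f p) (coordMap f p e) w (fderiv ℝ (coordMap f p) e u) := by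
  rw [eventually_nhds_coord]
  filter_upwards [eventually_fderiv_coordMap hf p, eventually_coordForm_fderiv_coordMap g hι p,
    eventually_mem_chart_source E' F (hf p).continuousAt] with q hdf hG ⟨hq, hfq⟩ w u
  rw [hG]
  simp [hdf, hq, hfq, (hl q).adjoint]

theorem IsParaquaternionicCRSubmersion.isLocalHorizontalLift [FiniteDimensional ℝ F]
    (hι : ContMDiff 𝓘(ℝ, F) 𝓘(ℝ, E) ∞ ι) (hf : IsParaquaternionicCRSubmersion σ g ι D σ' g' f)
    (hl : ∀ q, IsHorizontalLift g ι D g' f q (l q)) (p : N) :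
    IsLocalHorizontalLift (coordMap ι p) (coordMap f p) (coordLift f l p) (g.coordForm (ι p))
      (g'.coordForm (f p)) (coord p p) := by
  have htwo : (2 : ℕ∞ω) ≤ ∞ := ENat.LEInfty.out
  have hi : ContDiffAt ℝ 2 (coordMap ι p : F → E) (coord p p) :=
    contDiffAt_coordMap ((hι p).of_le htwo)
  have hf' : ContDiffAt ℝ 2 (coordMap f p : F → E') (coord p p) :=
    contDiffAt_coordMap ((hf.submersion.smooth p).of_le htwo)
  have hadjoint := eventually_coordLift_adjoint hι hf.submersion.smooth hl p
  refine ⟨hi, hf', differentiableAt_of_adjoint_fderiv hi hf' ?_ ?_ (fun u hu ↦ ?_) hadjoint,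
    eventually_coordLift_isSection hf.submersion.smooth hl p, hadjoint⟩
  · simpa using g.differentiableAt_coordForm
  · simpa using g'.differentiableAt_coordForm
  · have hofModel : ofModel p p u = 0 := hf.eq_zero_of_inducedForm_eq_zero fun w ↦ by
      have hw := (eventually_coordForm_fderiv_coordMap g hι p).self_of_nhds u (toModel p p w)
      rw [hu] at hw
      simpa using hw.symm
    simpa using congr(toModel p p $hofModel)

lemma IsParaquaternionicCRSubmersion.eventually_ambientLift_comp_mem_span
    (hι : ContMDiff 𝓘(ℝ, F) 𝓘(ℝ, E) ∞ ι) (hf : IsParaquaternionicCRSubmersion σ g ι D σ' g' f)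
    (hl : ∀ q, IsHorizontalLift g ι D g' f q (l q)) {p : N} {U : Set M}
    {J : Fin 3 → ∀ x : M, TangentSpace 𝓘(ℝ, E) x →L[ℝ] TangentSpace 𝓘(ℝ, E) x}
    (hJ : IsCanonicalLocalBasis σ.fiber U J) (hU : ι p ∈ U) {V : Set M'} (hV : IsOpen V)
    {A : ∀ x : M', TangentSpace 𝓘(ℝ, E') x →L[ℝ] TangentSpace 𝓘(ℝ, E') x}
    (hA : ∀ y ∈ V, A y ∈ σ'.fiber y) (hfp : f p ∈ V) :
    ∀ᶠ e in 𝓝 (coord p p),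
      ambientLift (coordMap ι p) (coordLift f l p) e ∘L coordEnd (f p) A (coordMap f p e)
        ∈ Submodule.span ℝ (Set.range fun β ↦ coordEnd (ι p) (J β) (coordMap ι p e) ∘L
          ambientLift (coordMap ι p) (coordLift f l p) e) := by
  have hf_smooth := hf.submersion.smooth
  rw [eventually_nhds_coord]
  filter_upwards [eventually_ambientLift_coordLift (f := f) (l := l) hι p,
    eventually_mem_chart_source E F (hι p).continuousAt,
    eventually_mem_chart_source E' F (hf_smooth p).continuousAt,
    (hι p).continuousAt.eventually_mem (hJ.isOpen.mem_nhds hU),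
    (hf_smooth p).continuousAt.eventually_mem (hV.mem_nhds hfp)]
    with q hL ⟨hq, hιq⟩ ⟨_, hfq⟩ hqU hqV
  obtain ⟨B, hB, hlB⟩ := (hl q).exists_mem_fiber_comp hf (hA _ hqV)
  rw [← hJ.span_eq _ hqU, Submodule.mem_span_range_iff_exists_fun] at hB
  obtain ⟨c, rfl⟩ := hB
  refine (Submodule.mem_span_range_iff_exists_fun ℝ).2 ⟨c, ContinuousLinearMap.ext fun w ↦ ?_⟩
  simp [hL, hq, hιq, hfq, hlB, sum_apply]

lemma IsHorizontalLift.exists_coordEnd_ambientLift (hι : ContMDiff 𝓘(ℝ, F) 𝓘(ℝ, E) ∞ ι)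
    (hf : IsParaquaternionicCRSubmersion σ g ι D σ' g' f) {p : N}
    (hl : IsHorizontalLift g ι D g' f p (l p)) {U' : Set M'}
    {J' : Fin 3 → ∀ x : M', TangentSpace 𝓘(ℝ, E') x →L[ℝ] TangentSpace 𝓘(ℝ, E') x}
    (hJ' : IsCanonicalLocalBasis σ'.fiber U' J') (hpU' : f p ∈ U') :
    ∃ (U : Set M) (J : Fin 3 → ∀ x : M, TangentSpace 𝓘(ℝ, E) x →L[ℝ] TangentSpace 𝓘(ℝ, E) x),
      IsCanonicalLocalBasis σ.fiber U J ∧ ι p ∈ U ∧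
      ∀ β w, coordEnd (ι p) (J β) (coord (ι p) (ι p))
          (ambientLift (coordMap ι p) (coordLift f l p) (coord p p) w)
        = ambientLift (coordMap ι p) (coordLift f l p) (coord p p)
          (coordEnd (f p) (J' β) (coord (f p) (f p)) w) := by
  obtain ⟨U, J, hJ, hpU, hJJ'⟩ := hl.exists_isCanonicalLocalBasis hf hJ' hpU'
  have hL := (eventually_ambientLift_coordLift (f := f) (l := l) hι p).self_of_nhds
  exact ⟨U, J, hJ, hpU, fun β w ↦ by simp [hL, hJJ']⟩

theorem IsParaquaternionicCRSubmersion.isParallelAt_projectedSymbol [FiniteDimensional ℝ E]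
    [FiniteDimensional ℝ F] [FiniteDimensional ℝ E']
    (hσ : IsAlmostParaquaternionicHermitian σ g) (hι : ContMDiff 𝓘(ℝ, F) 𝓘(ℝ, E) ∞ ι)
    (hf : IsParaquaternionicCRSubmersion σ g ι D σ' g' f)
    (hl : ∀ q, IsHorizontalLift g ι D g' f q (l q)) {p : N} {R : E →L[ℝ] E'}
    (hR : ∀ e w, g'.coordForm (f p) (coord (f p) (f p)) (R e) w
      = g.coordForm (ι p) (coord (ι p) (ι p)) e
        (ambientLift (coordMap ι p) (coordLift f l p) (coord p p) w))
    {Γ : E →L[ℝ] E →L[ℝ] E} (hΓ : IsParallelAt σ (ι p) Γ) :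
    IsParallelAt σ' (f p) (projectedSymbol R Γ (coordMap ι p) (coordLift f l p) (coord p p)) := by
  intro V A hV hA hAσ hfp v
  obtain ⟨U', J', hpU', hJ'⟩ := σ'.exists_basis (f p)
  obtain ⟨U, J, hJ, hpU, hJL⟩ := (hl p).exists_coordEnd_ambientLift hι hf hJ' hpU'
  have hlift := hf.isLocalHorizontalLift hι hl p
  have hι_center : coordMap (F := F) ι p (coord p p) = coord (E := E) (ι p) (ι p) := by simp
  have hf_center : coordMap (F := F) f p (coord p p) = coord (E := E') (f p) (f p) := by simp
  have hRL := leftInverse_of_adjoint_of_isometry g'.coordForm_nondegenerate hR <| by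
    simpa only [hι_center, hf_center] using hlift.isometry.self_of_nhds
  have hRJ (β : Fin 3) := adjoint_apply_of_skew g'.coordForm_nondegenerate hR
    (hJ.coordForm_apply_left hσ hpU β)
    (hJ'.coordForm_apply_left (hf.isAlmostParaquaternionicHermitian hσ) hpU' β) (hJL β)
  have hspan := hf.eventually_ambientLift_comp_mem_span hι hl hJ hpU hV hAσ hfp
  rw [← hJ'.span_range_coordEnd hpU', ← hf_center]
  refine hlift.covDerivEnd_mem_span (J := fun β ↦ coordEnd (ι p) (J β)) (fun β ↦ ?_)
    (fun β v ↦ ?_) ?_ hRL ?_ ?_ ?_ hspan v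
  all_goals simp only [hι_center, hf_center]
  · exact differentiableAt_coordEnd (hJ.smooth β) hJ.isOpen hpU
  · rw [hJ.span_range_coordEnd hpU]
    exact hΓ U (J β) hJ.isOpen (hJ.smooth β)
      (fun y hy ↦ hJ.span_eq y hy ▸ Submodule.subset_span ⟨β, rfl⟩) hpU v
  · exact hJL
  · exact hRJ
  · exact hJ'.linearIndependent_coordEnd hpU'
  · exact differentiableAt_coordEnd hA hV hfp

theorem IsParaquaternionicCRSubmersion.exists_isLeviCivitaSymbol_isParallelAt
    [FiniteDimensional ℝ E] [FiniteDimensional ℝ F] [FiniteDimensional ℝ E']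
    (hσ : IsParaquaternionicKahler σ g) (hι : ContMDiff 𝓘(ℝ, F) 𝓘(ℝ, E) ∞ ι)
    (hf : IsParaquaternionicCRSubmersion σ g ι D σ' g' f) (p : N) :
    ∃ Γ', IsLeviCivitaSymbol (g'.coordForm (f p)) (coord (f p) (f p)) Γ' ∧
      IsParallelAt σ' (f p) Γ' := by
  obtain ⟨hhermitian, hsymbol⟩ := isParaquaternionicKahler_iff.1 hσ
  obtain ⟨Γ, hΓ, hparallel⟩ := hsymbol (ι p)
  choose l hl using hf.exists_isHorizontalLift
  obtain ⟨R, hR⟩ := exists_adjoint_of_nondegenerate g'.coordForm_nondegenerate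
    (g.coordForm (ι p) (coord (ι p) (ι p)))
    (ambientLift (coordMap ι p) (coordLift f l p) (coord p p))
  refine ⟨projectedSymbol R Γ (coordMap ι p) (coordLift f l p) (coord p p), ?_,
    hf.isParallelAt_projectedSymbol hhermitian hι hl hR hparallel⟩
  have hι_center : coordMap (F := F) ι p (coord p p) = coord (E := E) (ι p) (ι p) := by simp
  have hf_center : coordMap (F := F) f p (coord p p) = coord (E := E') (f p) (f p) := by simp
  rw [← hι_center] at hΓ hR
  rw [← hf_center] at hR ⊢
  refine (hf.isLocalHorizontalLift hι hl p).isLeviCivitaSymbol ?_ ?_ ?_ ?_ ?_ hR hΓ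
  all_goals simp only [hι_center, hf_center]
  · exact g.differentiableAt_coordForm
  · exact g'.differentiableAt_coordForm
  · exact g.coordForm_symm
  · exact g'.coordForm_symm
  · exact g'.coordForm_nondegenerate

end CoordLift

end ParaquaternionicCR

end

theorem mainTheorem8_general
    {E : Type*} [NormedAddCommGroup E] [NormedSpace ℝ E] [FiniteDimensional ℝ E]
    {M : Type*} [TopologicalSpace M] [ChartedSpace E M] [IsManifold 𝓘(ℝ, E) ∞ M]
    {F : Type*} [NormedAddCommGroup F] [NormedSpace ℝ F]
    {N : Type*} [TopologicalSpace N] [ChartedSpace F N] [IsManifold 𝓘(ℝ, F) ∞ N]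
    {E' : Type*} [NormedAddCommGroup E'] [NormedSpace ℝ E'] [FiniteDimensional ℝ E']
    {M' : Type*} [TopologicalSpace M'] [ChartedSpace E' M'] [IsManifold 𝓘(ℝ, E') ∞ M']
    (σ : ParaquaternionicCR.AlmostParaquaternionicStructure E M)
    (g : ParaquaternionicCR.SemiRiemannianMetric E M)
    (hM : ParaquaternionicCR.IsParaquaternionicKahler σ g)
    (ι : N → M) (hι : ContMDiff 𝓘(ℝ, F) 𝓘(ℝ, E) ∞ ι)
    (D : ∀ p : N, Submodule ℝ (TangentSpace 𝓘(ℝ, F) p))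
    (σ' : ParaquaternionicCR.AlmostParaquaternionicStructure E' M')
    (g' : ParaquaternionicCR.SemiRiemannianMetric E' M') (f : N → M')
    (hf : ParaquaternionicCR.IsParaquaternionicCRSubmersion σ g ι D σ' g' f) :
    ParaquaternionicCR.IsParaquaternionicKahler σ' g' := by
  refine ParaquaternionicCR.isParaquaternionicKahler_iff.2
    ⟨hf.isAlmostParaquaternionicHermitian hM.hermitian, fun x ↦ ?_⟩
  obtain ⟨p, rfl⟩ := hf.submersion.surjective x
  have := hf.finiteDimensional p
  exact hf.exists_isLeviCivitaSymbol_isParallelAt hM hι p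

theorem mainTheorem8
    {E : Type*} [NormedAddCommGroup E] [NormedSpace ℝ E] [FiniteDimensional ℝ E]
    {M : Type*} [TopologicalSpace M] [T2Space M] [SecondCountableTopology M]
    [ChartedSpace E M] [IsManifold 𝓘(ℝ, E) ∞ M]
    {F : Type*} [NormedAddCommGroup F] [NormedSpace ℝ F] [FiniteDimensional ℝ F]
    {N : Type*} [TopologicalSpace N] [T2Space N] [SecondCountableTopology N]
    [ChartedSpace F N] [IsManifold 𝓘(ℝ, F) ∞ N]
    {E' : Type*} [NormedAddCommGroup E'] [NormedSpace ℝ E'] [FiniteDimensional ℝ E']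
    {M' : Type*} [TopologicalSpace M'] [T2Space M'] [SecondCountableTopology M']
    [ChartedSpace E' M'] [IsManifold 𝓘(ℝ, E') ∞ M']
    (σ : ParaquaternionicCR.AlmostParaquaternionicStructure E M)
    (g : ParaquaternionicCR.SemiRiemannianMetric E M)
    (hM : ParaquaternionicCR.IsParaquaternionicKahler σ g)
    (ι : N → M) (D : ∀ p : N, Submodule ℝ (TangentSpace 𝓘(ℝ, F) p))
    (hN : ParaquaternionicCR.IsParaquaternionicCRSubmanifold σ g ι D)
    (σ' : ParaquaternionicCR.AlmostParaquaternionicStructure E' M')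
    (g' : ParaquaternionicCR.SemiRiemannianMetric E' M')
    (hM' : ParaquaternionicCR.IsAlmostParaquaternionicHermitian σ' g')
    (f : N → M')
    (hf : ParaquaternionicCR.IsParaquaternionicCRSubmersion σ g ι D σ' g' f) :
    ParaquaternionicCR.IsParaquaternionicKahler σ' g' :=
  mainTheorem8_general σ g hM ι hN.immersion.contMDiff D σ' g' f hf
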